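/- Let $\langle x,y\rangle=x^1y^1+x^2y^2-x^3y^3-x^4y^4$ on $\mathbb{R}^4$ and let $\mathbb{A}\mathrm{d}\mathbb{S}^3=\mathrm{P}(\{\langle x,x\rangle<0\})\subset\mathbb{R}\mathrm{P}^3$ be Anti-de Sitter space, with the Lorentzian metric of curvature $-1$ induced from $\{\langle x,x\rangle=-1\}$ and with boundary at infinity $\partial_\infty\mathbb{A}\mathrm{d}\mathbb{S}^3=\mathrm{P}(\{\langle x,x\rangle=0\})$. A smooth embedded spacelike surface $S\subset\mathbb{A}\mathrm{d}\mathbb{S}^3$ is \emph{maximal} if its shape operator $B=\nabla N$ has zero trace ($N$ being a unit normal field), and it is \emph{entire} if it is a topological open disc whose frontier $\partial_\infty S=\overline S\setminus S$ in $\mathbb{R}\mathrm{P}^3$ is contained in $\partial_\infty\mathbb{A}\mathrm{d}\mathbb{S}^3$. Let $\|\lambda\|_\infty\in[0,\infty]$ denote the supremum over $S$ of the absolute values of the principal curvatures (the eigenvalues of $B$). The \emph{convex hull} of $\partial_\infty S$ is the intersection of the closed half-spaces, bounded by projective planes disjoint from $\partial_\infty S$ (in affine charts of $\mathbb{R}\mathrm{P}^3$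 containing $\partial_\infty S$), which contain $\partial_\infty S$. The \emph{width} $w$ of the convex hull is the supremum of the lengths of the timelike geodesic segments of $\mathbb{A}\mathrm{d}\mathbb{S}^3$ contained in it (and $w=0$ if there are none). Let $S$ be an entire maximal surface in $\mathbb{A}\mathrm{d}\mathbb{S}^3$ with $\|\lambda\|_\infty<1$, and let $w$ be the width of the convex hull of $\partial_\infty S$. Then $w<\pi/2$ and $$\tan w\le\frac{2\|\lambda\|_\infty}{1-\|\lambda\|_\infty^2}\,.$$ -/

import Mathlib

open scoped ContDiff LinearAlgebra.Projectivization

noncomputable section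

namespace AdS

/-- The vector space underlying `ℝ^{2,2}`. -/
abbrev R22 : Type := Fin 4 → ℝ

/-- The symmetric bilinear form of signature `(2,2)` on `ℝ⁴`. -/
def form (x y : R22) : ℝ := x 0 * y 0 + x 1 * y 1 - x 2 * y 2 - x 3 * y 3

/-- The quadric `⟨x, x⟩ = -1`, double cover of Anti-de Sitter space. -/
def AdSHat : Set R22 := {x | form x x = -1}

/-- Three-dimensional real projective space. -/
abbrev RP3 : Type := ℙ ℝ R22

/-- The quotient topology on projective space. -/
instance instTopologicalSpaceRP3 : TopologicalSpace RP3 :=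
  inferInstanceAs (TopologicalSpace (Quotient (projectivizationSetoid ℝ R22)))

/-- Anti-de Sitter space, as a domain of `ℝP³`. The sign of `⟨x, x⟩` does not depend on the
representative. -/
def AdS3 : Set RP3 := {x | form x.rep x.rep < 0}

/-- The boundary at infinity of Anti-de Sitter space in `ℝP³`. -/
def boundaryAtInfinity : Set RP3 := {x | form x.rep x.rep = 0}

theorem ne_zero_of_mem_AdSHat {x : R22} (hx : x ∈ AdSHat) : x ≠ 0 := by
  rintro rfl
  simp [AdSHat, form] at hx

/-- The covering map from the quadric `⟨x, x⟩ = -1` to Anti-de Sitter space. -/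
def proj (x : R22) (hx : x ∈ AdSHat) : RP3 :=
  Projectivization.mk ℝ x (ne_zero_of_mem_AdSHat hx)

/-! ### Spacelike embedded surfaces -/

/-- The parameter plane of local parametrizations. -/
abbrev E2 : Type := EuclideanSpace ℝ (Fin 2)

/-- `f : U → ℝ^{2,2}` is (the lift to the double cover of) a smooth spacelike parametrization of a
relatively open part of the subset `S` of Anti-de Sitter space: `U` is open, `f` is smooth with
values in the quadric, the first fundamental form is positive definite (so `f` is an immersion),
and `u ↦ [f u]` is a homeomorphism of `U` onto a relatively open subset of `S`. -/
structure IsSpacelikePatch (S : Set RP3) (U : Set E2) (f : E2 → R22) : Prop where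
  isOpen : IsOpen U
  smooth : ContDiffOn ℝ ∞ f U
  mem_AdSHat : ∀ u ∈ U, f u ∈ AdSHat
  spacelike : ∀ u ∈ U, ∀ v : E2, v ≠ 0 → 0 < form (fderiv ℝ f u v) (fderiv ℝ f u v)
  isEmbedding : Topology.IsEmbedding (fun u : U => proj (f u) (mem_AdSHat u u.2))
  range_open : ∃ W : Set RP3, IsOpen W ∧
    Set.range (fun u : U => proj (f u) (mem_AdSHat u u.2)) = S ∩ W

/-- `S` is a smooth embedded spacelike surface in Anti-de Sitter space. -/
def IsSpacelikeSurface (S : Set RP3) : Prop :=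
  ∀ x ∈ S, ∃ (U : Set E2) (f : E2 → R22) (hf : IsSpacelikePatch S U f) (u : E2) (hu : u ∈ U),
    proj (f u) (hf.mem_AdSHat u hu) = x

/-- `N` is a smooth (timelike) unit normal field along the parametrization `f : U → AdSHat`. -/
structure IsUnitNormal (U : Set E2) (f N : E2 → R22) : Prop where
  smooth : ContDiffOn ℝ ∞ N U
  unit : ∀ u ∈ U, form (N u) (N u) = -1
  tangent : ∀ u ∈ U, form (N u) (f u) = 0
  normal : ∀ u ∈ U, ∀ v : E2, form (N u) (fderiv ℝ f u v) = 0

/-- The covariant derivative `∇_v X` of Anti-de Sitter space, at the point `f u`, of a vector field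
`X` along `f`: the orthogonal projection of the flat derivative of `X` to `T_{f u} = (f u)^⊥`. -/
def covDeriv (f X : E2 → R22) (u v : E2) : R22 :=
  fderiv ℝ X u v + form (fderiv ℝ X u v) (f u) • f u

/-- `B` is the shape operator `v ↦ ∇_v N` at the parameter `u`, where the tangent plane of the
surface is identified with the parameter plane through the (injective) differential of `f`. -/
def IsShapeOperator (f N : E2 → R22) (u : E2) (B : E2 →ₗ[ℝ] E2) : Prop :=
  ∀ v : E2, fderiv ℝ f u (B v) = covDeriv f N u v

/-- `S` is a maximal surface: a smooth embedded spacelike surface with traceless shape operator. -/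
def IsMaximalSurface (S : Set RP3) : Prop :=
  IsSpacelikeSurface S ∧
    ∀ (U : Set E2) (f N : E2 → R22), IsSpacelikePatch S U f → IsUnitNormal U f N →
      ∀ u ∈ U, ∀ B : E2 →ₗ[ℝ] E2, IsShapeOperator f N u B → LinearMap.trace ℝ E2 B = 0

/-- `k` is a principal curvature of `S` at some point, i.e. an eigenvalue of the shape operator
(with respect to one of the two choices of unit normal). -/
def IsPrincipalCurvature (S : Set RP3) (k : ℝ) : Prop :=
  ∃ (U : Set E2) (f N : E2 → R22) (u : E2) (B : E2 →ₗ[ℝ] E2),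
    IsSpacelikePatch S U f ∧ IsUnitNormal U f N ∧ u ∈ U ∧ IsShapeOperator f N u B ∧
      Module.End.HasEigenvalue B k

/-- `‖λ‖_∞ ∈ [0, ∞]`, the supremum of the absolute values of the principal curvatures of `S`. -/
def curvatureNorm (S : Set RP3) : ENNReal :=
  ⨆ (k : ℝ) (_ : IsPrincipalCurvature S k), ENNReal.ofReal |k|

/-- The boundary at infinity `∂_∞ S` of a surface `S`: its frontier `closure S \ S` in `ℝP³`. -/
def frontierAtInfinity (S : Set RP3) : Set RP3 := closure S \ S

/-- `S` is entire: a topological (open) disc whose frontier lies in the boundary at infinity. -/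
def IsEntire (S : Set RP3) : Prop :=
  Nonempty (S ≃ₜ Metric.ball (0 : E2) 1) ∧ frontierAtInfinity S ⊆ boundaryAtInfinity

/-! ### Convex hull and width -/

/-- The sign of `sideProduct a b x` tells on which side of the pair of projective planes
`a^⊥`, `b^⊥` the point `x` lies (it does not depend on the representative of `x`): if `a` and `b`
are linearly independent, the complement of the two planes in `ℝP³` has exactly two connected
components, the half-spaces `sideProduct a b > 0` and `sideProduct a b < 0`. In the affine chart
complementary to `b^⊥`, these are the two half-spaces bounded by `a^⊥`. -/
def sideProduct (a b : R22) (x : RP3) : ℝ := form a x.rep * form b x.rep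

/-- The convex hull in `ℝP³` of a curve `Γ`: the intersection of all closed half-spaces, bounded by
a plane `a^⊥` disjoint from `Γ` in the affine chart complementary to a plane `b^⊥` disjoint from
`Γ`, taken on the side containing `Γ`. -/
def convexHullAtInfinity (Γ : Set RP3) : Set RP3 :=
  {x | ∀ a b : R22, (∀ y ∈ Γ, 0 < sideProduct a b y) → 0 ≤ sideProduct a b x}

theorem geodesic_mem_AdSHat {p v : R22} (hp : p ∈ AdSHat) (hv : form v v = -1)
    (hpv : form p v = 0) (t : ℝ) : Real.cos t • p + Real.sin t • v ∈ AdSHat := by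
  have h : form (Real.cos t • p + Real.sin t • v) (Real.cos t • p + Real.sin t • v) =
      Real.cos t ^ 2 * form p p + 2 * Real.cos t * Real.sin t * form p v
        + Real.sin t ^ 2 * form v v := by
    simp only [form, Pi.add_apply, Pi.smul_apply, smul_eq_mul]; ring
  have hp' : form p p = -1 := hp
  change form _ _ = -1
  rw [h, hp', hv, hpv]
  linear_combination -Real.sin_sq_add_cos_sq t

/-- `L` is the length of a timelike geodesic contained in `C`, i.e. of a segment
`t ↦ [cos t p + sin t v]`, `0 ≤ t ≤ L`, parametrized with unit speed; `p` is the initial point and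
`v` the unit timelike initial velocity. Timelike geodesics are closed of length `π`, so a segment
that does not overlap itself has `L ≤ π`. Segments reduced to a point (`L = 0`) are allowed. -/
def IsTimelikeGeodesicLength (C : Set RP3) (L : ℝ) : Prop :=
  0 ≤ L ∧ L ≤ Real.pi ∧
    ∃ (p v : R22) (hp : p ∈ AdSHat) (hv : form v v = -1) (hpv : form p v = 0),
      ∀ t ∈ Set.Icc 0 L,
        proj (Real.cos t • p + Real.sin t • v) (geodesic_mem_AdSHat hp hv hpv t) ∈ C

/-- The width of the convex hull of a curve `Γ`: the supremum of the lengths of the timelike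
geodesics contained in it. -/
def width (Γ : Set RP3) : ℝ :=
  sSup {L | IsTimelikeGeodesicLength (convexHullAtInfinity Γ) L}

end AdS

end

/-!
# The width of the convex hull of an entire maximal surface

Let `S` be an entire spacelike surface whose principal curvatures are bounded by `k < 1` in
absolute value, and let `T` be its preimage in the quadric `⟨x, x⟩ = -1`.

* In any orthonormal frame, the spacelike coordinates restrict to a proper local homeomorphism
  `T → ℝ²`, hence to a covering map, and `T` is the union of a global smooth graph and its antipode.
* Following the graph along rays centred at `q ∈ T` gives `|⟨x, q⟩| ≥ 1` for `x ∈ T`, and that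
  `x ↦ |⟨x, q⟩|` is proper on `T`.
* If `N` is the unit normal at `x ∈ T`, a maximum argument gives `|⟨N, q⟩| ≤ k' |⟨x, q⟩|` for all
  `q ∈ T` and `k' > k`; the same holds on the closure of `S`. The planes orthogonal to `±N - c x`
  with `c > k` are therefore disjoint from the boundary at infinity of `S`.
* A point `y` of the convex hull hence satisfies `⟨x, y⟩ = 0` or `(1 + k²) ⟨x, y⟩² ≥ 1`, and since
  every timelike geodesic meets `S`, a segment contained in the hull has length at most
  `2 arctan k`.
-/

noncomputable section

namespace AdS

/-! ### The bilinear form and orthonormal frames -/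

/-! The geometric core is a first-order comparison on a complete surface. For a fixed point `q` of
the double cover put `u = ⟨x, q⟩` and `v = ⟨N, q⟩`, and let `τ` be the tangential part of `q` at
`x`. The gradients of `u` and `v` are `τ` and `Bτ`, so with `K = ‖λ‖_∞`, moving along `τ` changes
`v` at a rate of at most `K` times that of `u`. At critical points of `u` one has `τ = 0`, that is
`u² + v² = 1`, and `|u| ≥ 1` forces `v = 0`. Descending along `|u|` therefore gives `|v| ≤ k|u|` for
every `k > K` (`IsSection.abs_form_normal_le`). What makes this descent legitimate is global: `|u| ≥
1` and the compactness of `{|u| ≤ c}` (`one_le_abs_form`, `isCompact_abs_form_le`), both obtained by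
comparing the surface with null curves issuing from `q`.

The bound survives on the frontier at infinity, where it places the planes `(±N - c x)^⊥`, `c > K`,
off the frontier (`IsSection.abs_form_mul_form_le`). A hull point `y` with `⟨x, y⟩ ≠ 0` then
satisfies `|⟨N, y⟩| ≤ c|⟨x, y⟩|`, while `⟨x, y⟩² + ⟨N, y⟩² ≥ 1` because the tangent plane is
spacelike (`one_le_mul_form_sq`). On a timelike geodesic through `x` this product is `-cos` of the
elapsed time, so hull points lie at time at most `arctan c` from `x` modulo `π`, or exactly at
`π/2`. A segment in the hull, being connected, has length at most `2 arctan K`, and the tangent of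
that is the stated bound. -/

theorem form_comm (x y : R22) : form x y = form y x := by
  simp only [form]; ring

@[simp] theorem form_add_left (x y z : R22) : form (x + y) z = form x z + form y z := by
  simp only [form, Pi.add_apply]; ring

@[simp] theorem form_add_right (x y z : R22) : form x (y + z) = form x y + form x z := by
  simp only [form, Pi.add_apply]; ring

@[simp] theorem form_sub_left (x y z : R22) : form (x - y) z = form x z - form y z := by
  simp only [form, Pi.sub_apply]; ring

@[simp] theorem form_sub_right (x y z : R22) : form x (y - z) = form x y - form x z := by
  simp only [form, Pi.sub_apply]; ring

@[simp] theorem form_smul_left (c : ℝ) (x y : R22) : form (c • x) y = c * form x y := by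
  simp only [form, Pi.smul_apply, smul_eq_mul]; ring

@[simp] theorem form_smul_right (c : ℝ) (x y : R22) : form x (c • y) = c * form x y := by
  simp only [form, Pi.smul_apply, smul_eq_mul]; ring

@[simp] theorem form_neg_left (x y : R22) : form (-x) y = -form x y := by
  simp only [form, Pi.neg_apply]; ring

@[simp] theorem form_neg_right (x y : R22) : form x (-y) = -form x y := by
  simp only [form, Pi.neg_apply]; ring

@[simp] theorem form_zero_left (x : R22) : form 0 x = 0 := by simp [form]

theorem continuous_form : Continuous fun x : R22 × R22 => form x.1 x.2 := by
  unfold form; fun_prop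

/-- The form as a continuous bilinear map. -/
def formCLM : R22 →L[ℝ] R22 →L[ℝ] ℝ :=
  LinearMap.toContinuousLinearMap <|
    (LinearMap.toContinuousLinearMap : (R22 →ₗ[ℝ] ℝ) ≃ₗ[ℝ] (R22 →L[ℝ] ℝ)).toLinearMap ∘ₗ
      LinearMap.mk₂ ℝ form form_add_left form_smul_left form_add_right form_smul_right

@[simp] theorem formCLM_apply (x y : R22) : formCLM x y = form x y := rfl

/-- A frame of `ℝ^{2,2}`: the orthonormal basis `e₁, e₂, p, v` with `p, v` timelike. -/
structure IsFrame (e₁ e₂ p v : R22) : Prop where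
  p_p : form p p = -1
  v_v : form v v = -1
  p_v : form p v = 0
  e₁_e₁ : form e₁ e₁ = 1
  e₂_e₂ : form e₂ e₂ = 1
  e₁_e₂ : form e₁ e₂ = 0
  e₁_p : form e₁ p = 0
  e₁_v : form e₁ v = 0
  e₂_p : form e₂ p = 0
  e₂_v : form e₂ v = 0

theorem exists_isFrame {p v : R22} (hp : form p p = -1) (hv : form v v = -1)
    (hpv : form p v = 0) : ∃ e₁ e₂ : R22, IsFrame e₁ e₂ p v := by
  have normalize : ∀ y : R22, 0 < form y y →
      form ((√(form y y))⁻¹ • y) ((√(form y y))⁻¹ • y) = 1 := by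
    intro y hy
    have h := Real.sq_sqrt hy.le
    have h' : √(form y y) ≠ 0 := (Real.sqrt_pos.2 hy).ne'
    rw [form_smul_left, form_smul_right]
    field_simp
    exact h.symm
  have hvp : form v p = 0 := by rw [form_comm, hpv]
  -- Orthogonal projection to `{p, v}^⊥`. Removing timelike components can only increase `⟨x, x⟩`,
  -- so a positive definite plane projects to a positive definite one; Gram–Schmidt is then run on
  -- the images of `a` and `b`.
  let P : R22 → R22 := fun x => x + form x p • p + form x v • v
  have hPp : ∀ x, form (P x) p = 0 := by
    intro x; simp only [P, form_add_left, form_smul_left, hp, hvp]; ring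
  have hPv : ∀ x, form (P x) v = 0 := by
    intro x; simp only [P, form_add_left, form_smul_left, hv, hpv]; ring
  have hPP : ∀ x, form (P x) (P x) = form x x + form x p ^ 2 + form x v ^ 2 := by
    intro x
    simp only [P, form_add_left, form_smul_left, form_add_right, form_smul_right, hv, hpv, hp, hvp,
      form_comm p x, form_comm v x]
    ring
  let a : R22 := ![1, 0, 0, 0]
  let b : R22 := ![0, 1, 0, 0]
  have ha : 0 < form (P a) (P a) := by
    rw [hPP]
    have : form a a = 1 := by simp [form, a]
    rw [this]; positivity
  obtain ⟨e₁, he₁, c, hc⟩ : ∃ e₁ : R22, form e₁ e₁ = 1 ∧ ∃ c : ℝ, e₁ = c • P a :=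
    ⟨_, normalize _ ha, _, rfl⟩
  have hep : form e₁ p = 0 := by rw [hc, form_smul_left, hPp, mul_zero]
  have hev : form e₁ v = 0 := by rw [hc, form_smul_left, hPv, mul_zero]
  let w : R22 := P b - form (P b) e₁ • e₁
  -- Writing `w` as a projection of a vector of the plane spanned by `a` and `b` gives its
  -- positivity with no further estimate.
  have hw : w = P (b - (form (P b) e₁ * c) • a) := by
    have : w = P b - form (P b) e₁ • c • P a := by rw [← hc]
    rw [this]
    generalize form (P b) e₁ = k
    simp only [P, form_sub_left, form_smul_left]
    module
  have hwp : form w p = 0 := by rw [hw, hPp]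
  have hwv : form w v = 0 := by rw [hw, hPv]
  have hwe : form e₁ w = 0 := by
    simp only [w, form_sub_right, form_smul_right, he₁, form_comm e₁ (P b)]; ring
  have hww : 0 < form w w := by
    rw [hw, hPP]
    have : form (b - (form (P b) e₁ * c) • a) (b - (form (P b) e₁ * c) • a)
        = 1 + (form (P b) e₁ * c) ^ 2 := by
      simp [form, a, b]; ring
    rw [this]; positivity
  refine ⟨e₁, (√(form w w))⁻¹ • w, hp, hv, hpv, he₁, normalize w hww, ?_, hep, hev, ?_, ?_⟩ <;>
    simp [hwp, hwv, hwe]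

namespace IsFrame

variable {e₁ e₂ p v : R22}

theorem expand (F : IsFrame e₁ e₂ p v) (x : R22) :
    x = form x e₁ • e₁ + form x e₂ • e₂ - form x p • p - form x v • v := by
  let b : Fin 4 → R22 := ![e₁, e₂, p, v]
  let s : Fin 4 → ℝ := ![1, 1, -1, -1]
  let A : Matrix (Fin 4) (Fin 4) ℝ := Matrix.of fun i j => s i * ((![1, 1, -1, -1] : R22) j * b i j)
  let B : Matrix (Fin 4) (Fin 4) ℝ := Matrix.of fun j i => b i j
  have hA : ∀ i y, A.mulVec y i = s i * form y (b i) := by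
    intro i y
    simp only [Matrix.mulVec, dotProduct, Fin.sum_univ_four, A, form, Matrix.of_apply]
    simp
    ring
  -- Orthonormality says only that the coordinate map `A` is a left inverse of the basis matrix `B`;
  -- for square matrices it is then a right inverse, which is the expansion.
  have hAB : A * B = 1 := by
    have key : ∀ i j, (A * B) i j = s i * form (b j) (b i) := fun i j => hA i (b j)
    obtain ⟨h1, h2, h3, h4, h5, h6, h7, h8, h9, h10⟩ := F
    ext i j
    rw [key]
    fin_cases i <;> fin_cases j <;> simp [b, s, form_comm e₂ e₁, form_comm p e₁, form_comm v e₁,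
      form_comm p e₂, form_comm v e₂, form_comm v p, h1, h2, h3, h4, h5, h6, h7, h8, h9, h10]
  have hx : B.mulVec (A.mulVec x) = x := by
    rw [Matrix.mulVec_mulVec, mul_eq_one_comm.1 hAB, Matrix.one_mulVec]
  ext j
  have : B.mulVec (A.mulVec x) j = ∑ i, s i * form x (b i) * b i j := by
    simp only [Matrix.mulVec, dotProduct, B, Matrix.of_apply] at hA ⊢
    exact Finset.sum_congr rfl fun i _ => by rw [hA]; ring
  rw [← congrFun hx j, this, Fin.sum_univ_four]
  simp [s, b]
  ring

theorem form_self (F : IsFrame e₁ e₂ p v) (x : R22) :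
    form x x = form x e₁ ^ 2 + form x e₂ ^ 2 - form x p ^ 2 - form x v ^ 2 := by
  conv_lhs => rw [F.expand x]
  obtain ⟨h1, h2, h3, h4, h5, h6, h7, h8, h9, h10⟩ := F
  simp only [form_add_left, form_sub_left, form_smul_left, form_add_right, form_sub_right,
    form_smul_right, form_comm e₂ e₁, form_comm p e₁, form_comm v e₁, form_comm p e₂,
    form_comm v e₂, form_comm v p, h1, h2, h3, h4, h5, h6, h7, h8, h9, h10]
  ring

theorem eq_zero_of_form_nonpos (F : IsFrame e₁ e₂ p v) {x : R22} (hp : form x p = 0)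
    (hv : form x v = 0) (hx : form x x ≤ 0) : x = 0 := by
  rw [F.form_self, hp, hv] at hx
  have h1 : form x e₁ = 0 := by nlinarith [sq_nonneg (form x e₁), sq_nonneg (form x e₂)]
  have h2 : form x e₂ = 0 := by nlinarith [sq_nonneg (form x e₁), sq_nonneg (form x e₂)]
  rw [F.expand x, h1, h2, hp, hv]; simp

/-- The two spacelike coordinates of a frame. -/
def coords (_ : IsFrame e₁ e₂ p v) : R22 →L[ℝ] E2 :=
  (EuclideanSpace.equiv (Fin 2) ℝ).symm.toContinuousLinearMap ∘L
    ContinuousLinearMap.pi ![formCLM.flip e₁, formCLM.flip e₂]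

@[simp] theorem coords_zero (F : IsFrame e₁ e₂ p v) (x : R22) : F.coords x 0 = form x e₁ := by
  simp [coords]

@[simp] theorem coords_one (F : IsFrame e₁ e₂ p v) (x : R22) : F.coords x 1 = form x e₂ := by
  simp [coords]

theorem norm_coords_sq (F : IsFrame e₁ e₂ p v) (x : R22) :
    ‖F.coords x‖ ^ 2 = form x e₁ ^ 2 + form x e₂ ^ 2 := by
  simp [EuclideanSpace.norm_sq_eq, Fin.sum_univ_two]

theorem form_eq_norm_coords (F : IsFrame e₁ e₂ p v) (x : R22) :
    form x x = ‖F.coords x‖ ^ 2 - form x p ^ 2 - form x v ^ 2 := by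
  rw [norm_coords_sq, F.form_self]

theorem coords_p (F : IsFrame e₁ e₂ p v) : F.coords p = 0 := by
  ext i; fin_cases i <;> simp [form_comm p, F.e₁_p, F.e₂_p]

/-- Points of the quadric with bounded spacelike coordinates are bounded. -/
theorem isCompact_inter (F : IsFrame e₁ e₂ p v) {T : Set R22} (hT : IsClosed T)
    (hTA : T ⊆ AdSHat) {K : Set E2} (hK : IsCompact K) : IsCompact (T ∩ F.coords ⁻¹' K) := by
  refine Metric.isCompact_of_isClosed_isBounded
    (hT.inter (hK.isClosed.preimage F.coords.continuous)) ?_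
  obtain ⟨C, hC⟩ := hK.isBounded.exists_norm_le
  refine isBounded_iff_forall_norm_le.2
    ⟨|C| * ‖e₁‖ + |C| * ‖e₂‖ + (|C| + 1) * ‖p‖ + (|C| + 1) * ‖v‖, ?_⟩
  rintro x ⟨hxT, hxK⟩
  have hn : ‖F.coords x‖ ^ 2 ≤ |C| ^ 2 :=
    pow_le_pow_left₀ (norm_nonneg _) ((hC _ hxK).trans (le_abs_self C)) 2
  have hx : form x x = -1 := hTA hxT
  have h := F.form_eq_norm_coords x
  rw [F.norm_coords_sq] at h hn
  have h1 : |form x e₁| ≤ |C| := by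
    refine abs_le_of_sq_le_sq ?_ (abs_nonneg C); nlinarith [sq_nonneg (form x e₂)]
  have h2 : |form x e₂| ≤ |C| := by
    refine abs_le_of_sq_le_sq ?_ (abs_nonneg C); nlinarith [sq_nonneg (form x e₁)]
  have h3 : |form x p| ≤ |C| + 1 := by
    refine abs_le_of_sq_le_sq ?_ (by positivity)
    nlinarith [sq_nonneg (form x v), abs_nonneg C]
  have h4 : |form x v| ≤ |C| + 1 := by
    refine abs_le_of_sq_le_sq ?_ (by positivity)
    nlinarith [sq_nonneg (form x p), abs_nonneg C]
  rw [F.expand x]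
  calc ‖form x e₁ • e₁ + form x e₂ • e₂ - form x p • p - form x v • v‖
      ≤ ‖form x e₁ • e₁‖ + ‖form x e₂ • e₂‖ + ‖form x p • p‖ + ‖form x v • v‖ :=
        (norm_sub_le _ _).trans <| add_le_add_left ((norm_sub_le _ _).trans <|
          add_le_add_left (norm_add_le _ _) _) _
    _ ≤ _ := by
        simp only [norm_smul, Real.norm_eq_abs]
        gcongr

end IsFrame

/-! ### The cross product -/

/-- The cross product of three vectors, defined by `⟨cross a b c, d⟩ = det (a, b, c, d)`. -/
def cross (a b c : R22) : R22 :=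
  ![-(a 1 * (b 2 * c 3 - b 3 * c 2) - a 2 * (b 1 * c 3 - b 3 * c 1) +
        a 3 * (b 1 * c 2 - b 2 * c 1)),
    a 0 * (b 2 * c 3 - b 3 * c 2) - a 2 * (b 0 * c 3 - b 3 * c 0) +
        a 3 * (b 0 * c 2 - b 2 * c 0),
    a 0 * (b 1 * c 3 - b 3 * c 1) - a 1 * (b 0 * c 3 - b 3 * c 0) +
        a 3 * (b 0 * c 1 - b 1 * c 0),
    -(a 0 * (b 1 * c 2 - b 2 * c 1) - a 1 * (b 0 * c 2 - b 2 * c 0) +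
        a 2 * (b 0 * c 1 - b 1 * c 0))]

theorem form_cross_first (a b c : R22) : form (cross a b c) a = 0 := by
  simp [form, cross]; ring

theorem form_cross_second (a b c : R22) : form (cross a b c) b = 0 := by
  simp [form, cross]; ring

theorem form_cross_third (a b c : R22) : form (cross a b c) c = 0 := by
  simp [form, cross]; ring

/-- The right side is the Gram determinant of `a, b, c`, with a plus sign because the form itself
has determinant `+1` in signature `(2,2)`. -/
theorem form_cross_self (a b c : R22) : form (cross a b c) (cross a b c) =
    form a a * (form b b * form c c - form b c ^ 2) - form a b * (form a b * form c c -
      form b c * form a c) + form a c * (form a b * form b c - form b b * form a c) := by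
  simp [form, cross]; ring

open Filter Topology Set

/-! ### Projective space and the double cover of a surface -/

theorem isQuotientMap_mk :
    IsQuotientMap fun x : {x : R22 // x ≠ 0} => (Projectivization.mk ℝ x.1 x.2 : RP3) :=
  isQuotientMap_quotient_mk' (s := projectivizationSetoid ℝ R22)

theorem eventually_mk_mem {x : R22} (hx : x ≠ 0) {Z : Set RP3}
    (hZ : Z ∈ 𝓝 (Projectivization.mk ℝ x hx : RP3)) :
    ∀ᶠ y in 𝓝 x, ∀ hy : y ≠ 0, (Projectivization.mk ℝ y hy : RP3) ∈ Z := by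
  have h := isQuotientMap_mk.continuous.tendsto (⟨x, hx⟩ : {x : R22 // x ≠ 0}) hZ
  rw [mem_map, nhds_subtype_eq_comap, mem_comap] at h
  obtain ⟨O, hO, hOZ⟩ := h
  filter_upwards [hO] with y hyO hy
  exact hOZ (show (⟨y, hy⟩ : {x : R22 // x ≠ 0}).1 ∈ O from hyO)

/-- Conditions phrased with the chosen representative `rep` are transferred to any other
representative, provided they define a cone. -/
theorem rep_mk_mem_iff {C : Set R22} (hC : ∀ c : ℝ, c ≠ 0 → ∀ x ∈ C, c • x ∈ C) {x : R22}
    (hx : x ≠ 0) : (Projectivization.mk ℝ x hx : RP3).rep ∈ C ↔ x ∈ C := by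
  obtain ⟨a, ha⟩ := Projectivization.exists_smul_eq_mk_rep ℝ x hx
  rw [← ha]
  refine ⟨fun h => ?_, fun h => hC _ a.ne_zero _ h⟩
  have := hC (a : ℝ)⁻¹ (inv_ne_zero a.ne_zero) _ h
  rwa [Units.smul_def, inv_smul_smul₀ a.ne_zero] at this

theorem isClosed_rep_mem {C : Set R22} (hC : ∀ c : ℝ, c ≠ 0 → ∀ x ∈ C, c • x ∈ C)
    (hcl : IsClosed C) : IsClosed {y : RP3 | y.rep ∈ C} := by
  rw [← isQuotientMap_mk.isClosed_preimage]
  convert hcl.preimage (continuous_subtype_val : Continuous fun x : {x : R22 // x ≠ 0} => x.1)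
    using 1
  ext x
  exact rep_mk_mem_iff hC x.2

theorem proj_eq_proj_iff {x y : R22} (hx : x ∈ AdSHat) (hy : y ∈ AdSHat) :
    proj x hx = proj y hy ↔ x = y ∨ x = -y := by
  rw [proj, proj, Projectivization.mk_eq_mk_iff']
  constructor
  · rintro ⟨a, rfl⟩
    have hx' : form (a • y) (a • y) = -1 := hx
    have hy' : form y y = -1 := hy
    rw [form_smul_left, form_smul_right, hy'] at hx'
    have : a = 1 ∨ a = -1 := mul_self_eq_one_iff.1 (by linarith)
    rcases this with rfl | rfl <;> simp
  · rintro (rfl | rfl)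
    · exact ⟨1, one_smul _ _⟩
    · exact ⟨-1, by simp⟩

theorem neg_mem_AdSHat {x : R22} (hx : x ∈ AdSHat) : -x ∈ AdSHat := by
  have : form x x = -1 := hx
  simp [AdSHat, this]

/-- The preimage of `S` in the quadric. -/
def doubleCover (S : Set RP3) : Set R22 := {x | ∃ hx : x ∈ AdSHat, proj x hx ∈ S}

theorem doubleCover_subset (S : Set RP3) : doubleCover S ⊆ AdSHat := fun _ h => h.1

theorem neg_mem_doubleCover {S : Set RP3} {x : R22} (hx : x ∈ doubleCover S) :
    -x ∈ doubleCover S := by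
  refine ⟨neg_mem_AdSHat hx.1, ?_⟩
  rw [(proj_eq_proj_iff (neg_mem_AdSHat hx.1) hx.1).2 (Or.inr rfl)]
  exact hx.2

theorem isClosed_AdSHat : IsClosed AdSHat :=
  isClosed_singleton.preimage (continuous_form.comp (continuous_id.prodMk continuous_id))

/-- A limit point in the quadric has `⟨x, x⟩ = -1`, so its image cannot lie on the boundary at
infinity, the only place where `S` may fail to be closed. This is the completeness of the surface.
-/
theorem isClosed_doubleCover {S : Set RP3} (hS : frontierAtInfinity S ⊆ boundaryAtInfinity) :
    IsClosed (doubleCover S) := by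
  refine isClosed_of_closure_subset fun x hx => ?_
  have hxA : x ∈ AdSHat := closure_minimal (doubleCover_subset S) isClosed_AdSHat hx
  refine ⟨hxA, ?_⟩
  by_contra hxS
  have hcl : proj x hxA ∈ closure S := by
    rw [mem_closure_iff_nhds]
    intro Z hZ
    obtain ⟨y, hy, hyS⟩ := mem_closure_iff_nhds.1 hx _ (eventually_mk_mem _ hZ)
    exact ⟨proj y hyS.1, hy _, hyS.2⟩
  have h0 := hS ⟨hcl, hxS⟩
  have := (rep_mk_mem_iff (C := {x | form x x = 0}) (by
    intro c _ x hx
    simp only [mem_ofPred_eq] at hx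
    simp [hx]) (ne_zero_of_mem_AdSHat hxA)).1 h0
  have hx1 : form x x = -1 := hxA
  simp only [mem_ofPred_eq, hx1] at this
  norm_num at this

/-! ### Local structure of the double cover -/

theorem IsSpacelikePatch.neg {S : Set RP3} {U : Set E2} {f : E2 → R22}
    (hf : IsSpacelikePatch S U f) : IsSpacelikePatch S U (fun u => -f u) := by
  have hm : ∀ u ∈ U, -f u ∈ AdSHat := fun u hu => neg_mem_AdSHat (hf.mem_AdSHat u hu)
  have heq : (fun u : U => proj (-f u) (hm u u.2)) =
      fun u : U => proj (f u) (hf.mem_AdSHat u u.2) :=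
    funext fun u => (proj_eq_proj_iff _ _).2 (Or.inr rfl)
  refine ⟨hf.isOpen, hf.smooth.neg, hm, ?_, ?_, ?_⟩
  · intro u hu v hv
    have : fderiv ℝ (fun u => -f u) u v = -fderiv ℝ f u v := by
      rw [fderiv_fun_neg]; rfl
    rw [this]
    simpa using hf.spacelike u hu v hv
  · rw [heq]; exact hf.isEmbedding
  · rw [heq]; exact hf.range_open

theorem exists_patch {S : Set RP3} (hS : IsSpacelikeSurface S) {x : R22}
    (hx : x ∈ doubleCover S) :
    ∃ (U : Set E2) (f : E2 → R22) (_ : IsSpacelikePatch S U f) (u : E2), u ∈ U ∧ f u = x := by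
  obtain ⟨U, f, hf, u, hu, h⟩ := hS _ hx.2
  rcases (proj_eq_proj_iff _ _).1 h with h | h
  · exact ⟨U, f, hf, u, hu, h⟩
  · exact ⟨U, _, hf.neg, u, hu, by simp [h]⟩

namespace IsSpacelikePatch

variable {S : Set RP3} {U : Set E2} {f : E2 → R22}

theorem mem_doubleCover (hf : IsSpacelikePatch S U f) {u : E2} (hu : u ∈ U) :
    f u ∈ doubleCover S := by
  obtain ⟨W, -, hW⟩ := hf.range_open
  exact ⟨hf.mem_AdSHat u hu, (hW.le (mem_range_self (⟨u, hu⟩ : U))).1⟩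

theorem contDiffAt (hf : IsSpacelikePatch S U f) {u : E2} (hu : u ∈ U) : ContDiffAt ℝ ∞ f u :=
  hf.smooth.contDiffAt (hf.isOpen.mem_nhds hu)

theorem tendsto (hf : IsSpacelikePatch S U f) {u : E2} (hu : u ∈ U) :
    Tendsto f (𝓝 u) (𝓝[doubleCover S] f u) :=
  tendsto_nhdsWithin_iff.2 ⟨(hf.contDiffAt hu).continuousAt,
    Eventually.mono (hf.isOpen.mem_nhds hu) fun _ hw => hf.mem_doubleCover hw⟩

theorem map_nhds_eq (hf : IsSpacelikePatch S U f) {u : E2} (hu : u ∈ U) :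
    map (fun u : U => proj (f u) (hf.mem_AdSHat u u.2)) (𝓝 ⟨u, hu⟩) =
      𝓝[S] (proj (f u) (hf.mem_AdSHat u hu)) := by
  obtain ⟨W, hWo, hW⟩ := hf.range_open
  rw [hf.isEmbedding.map_nhds_eq, hW]
  exact nhdsWithin_inter_of_mem' (mem_nhdsWithin_of_mem_nhds
    (hWo.mem_nhds (hW.le (mem_range_self (⟨u, hu⟩ : U))).2))

/-- Properties holding on the double cover near `f u` hold on `S` near `[f u]`. -/
theorem eventually_proj (hf : IsSpacelikePatch S U f) {u : E2} (hu : u ∈ U) {P : RP3 → Prop}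
    (h : ∀ᶠ y in 𝓝[doubleCover S] f u, ∀ hy : y ∈ AdSHat, P (proj y hy)) :
    ∀ᶠ y in 𝓝[S] (proj (f u) (hf.mem_AdSHat u hu)), P y := by
  rw [← hf.map_nhds_eq hu, eventually_map]
  have h1 := (hf.tendsto hu).eventually h
  rw [nhds_subtype_eq_comap]
  exact (tendsto_comap.eventually h1).mono fun w hw => hw _

/-- A patch is open as a map to the double cover. -/
theorem nhdsWithin_le (hf : IsSpacelikePatch S U f) {u : E2} (hu : u ∈ U) :
    𝓝[doubleCover S] f u ≤ map f (𝓝 u) := by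
  intro V hV
  rw [mem_map] at hV
  have hfu : form (f u) (f u) = -1 := hf.mem_AdSHat u hu
  -- The projective statement determines points only up to sign; the sign of the product with `f u`
  -- tells the two lifts apart near `f u`.
  have hneg : ∀ᶠ y in 𝓝 (f u), form y (f u) < 0 := by
    have : Continuous fun y => form y (f u) :=
      continuous_form.comp (continuous_id.prodMk continuous_const)
    exact this.continuousAt.eventually_lt continuousAt_const (by rw [hfu]; norm_num)
  have hV' : ∀ᶠ w in 𝓝 u, f w ∈ V ∧ form (f w) (f u) < 0 :=
    (show ∀ᶠ w in 𝓝 u, f w ∈ V from hV).and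
      ((hf.contDiffAt hu).continuousAt.eventually hneg)
  have hZ : ∀ᶠ y in 𝓝[S] (proj (f u) (hf.mem_AdSHat u hu)),
      ∃ w : U, (f w ∈ V ∧ form (f w) (f u) < 0) ∧ proj (f w) (hf.mem_AdSHat w w.2) = y := by
    rw [← hf.map_nhds_eq hu, eventually_map, nhds_subtype_eq_comap]
    exact (tendsto_comap.eventually hV').mono fun w hw => ⟨w, hw, rfl⟩
  rw [eventually_nhdsWithin_iff] at hZ
  filter_upwards [nhdsWithin_le_nhds (eventually_mk_mem _ hZ), nhdsWithin_le_nhds hneg,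
    self_mem_nhdsWithin] with y hy hyn hyT
  obtain ⟨w, ⟨hwV, hwn⟩, hw⟩ := hy (ne_zero_of_mem_AdSHat hyT.1) hyT.2
  rcases (proj_eq_proj_iff (hf.mem_AdSHat w w.2) hyT.1).1 hw with h | h
  · rwa [← h]
  · rw [h, form_neg_left] at hwn
    linarith

end IsSpacelikePatch

variable {S : Set RP3} {e₁ e₂ p v : R22}

/-- Near each of its points, the double cover is a smooth spacelike graph over the spacelike
coordinates of a frame. -/
theorem exists_local_section (hS : IsSpacelikeSurface S) (F : IsFrame e₁ e₂ p v) {x : R22}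
    (hx : x ∈ doubleCover S) :
    ∃ σ : E2 → R22, ContDiffAt ℝ ∞ σ (F.coords x) ∧ σ (F.coords x) = x ∧
      (∀ᶠ z in 𝓝 (F.coords x), σ z ∈ doubleCover S ∧ F.coords (σ z) = z) ∧
      (∀ᶠ y in 𝓝[doubleCover S] x, σ (F.coords y) = y) ∧
      ∀ w : E2, w ≠ 0 → 0 < form (fderiv ℝ σ (F.coords x) w) (fderiv ℝ σ (F.coords x) w) := by
  obtain ⟨U, f, hf, u, hu, rfl⟩ := exists_patch hS hx
  have hfd := (hf.contDiffAt hu).differentiableAt (by simp)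
  -- A vector with vanishing spacelike coordinates has nonpositive square, so it is not a nonzero
  -- tangent vector. This allows the inverse function theorem.
  have hinj : Function.Injective (F.coords ∘L fderiv ℝ f u) := by
    rw [injective_iff_map_eq_zero]
    intro w hw
    by_contra hne
    have h1 := hf.spacelike u hu w hne
    have hw' : F.coords (fderiv ℝ f u w) = 0 := hw
    rw [F.form_eq_norm_coords, hw'] at h1
    simp only [norm_zero] at h1
    nlinarith [sq_nonneg (form (fderiv ℝ f u w) p), sq_nonneg (form (fderiv ℝ f u w) v)]
  let D : E2 ≃L[ℝ] E2 :=
    (LinearEquiv.ofInjectiveEndo (F.coords ∘L fderiv ℝ f u).toLinearMap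
      hinj).toContinuousLinearEquiv
  have hD : (D : E2 →L[ℝ] E2) = F.coords ∘L fderiv ℝ f u := by ext; rfl
  have hg : ContDiffAt ℝ ∞ (F.coords ∘ f) u :=
    F.coords.contDiff.contDiffAt.comp u (hf.contDiffAt hu)
  have hgd : HasFDerivAt (F.coords ∘ f) (D : E2 →L[ℝ] E2) u := by
    rw [hD]; exact F.coords.hasFDerivAt.comp u hfd.hasFDerivAt
  have hn : (∞ : WithTop ℕ∞) ≠ 0 := by simp
  let g := hg.toOpenPartialHomeomorph (F.coords ∘ f) hgd hn
  have hgu : u ∈ g.source := hg.mem_toOpenPartialHomeomorph_source hgd hn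
  have hgs : g.symm (F.coords (f u)) = u := g.left_inv hgu
  have hgt : F.coords (f u) ∈ g.target := hg.image_mem_toOpenPartialHomeomorph_target hgd hn
  have hsm : ContDiffAt ℝ ∞ g.symm (F.coords (f u)) := hg.to_localInverse hgd hn
  have hcont : Tendsto g.symm (𝓝 (F.coords (f u))) (𝓝 u) := by
    have := hsm.continuousAt.tendsto
    rwa [hgs] at this
  have hsec : ∀ᶠ z in 𝓝 (F.coords (f u)), f (g.symm z) ∈ doubleCover S ∧
      F.coords (f (g.symm z)) = z := by
    filter_upwards [hcont.eventually (hf.isOpen.mem_nhds hu), g.open_target.mem_nhds hgt]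
      with z hz hzt
    exact ⟨hf.mem_doubleCover hz, g.right_inv hzt⟩
  have hsm' : ContDiffAt ℝ ∞ (fun z => f (g.symm z)) (F.coords (f u)) :=
    ContDiffAt.comp (g := f) _ (by rw [hgs]; exact hf.contDiffAt hu) hsm
  refine ⟨fun z => f (g.symm z), hsm', by simp only [hgs], hsec, ?_, ?_⟩
  · refine hf.nhdsWithin_le hu ?_
    rw [mem_map]
    filter_upwards [g.open_source.mem_nhds hgu] with w hw
    change f (g.symm (g w)) = f w
    rw [g.left_inv hw]
  · intro w hw
    have hd : fderiv ℝ (fun z => f (g.symm z)) (F.coords (f u)) =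
        fderiv ℝ f u ∘L fderiv ℝ g.symm (F.coords (f u)) := by
      have h1 : HasFDerivAt f (fderiv ℝ f u) (g.symm (F.coords (f u))) := by
        rw [hgs]; exact hfd.hasFDerivAt
      exact (h1.comp _ (hsm.differentiableAt (by simp)).hasFDerivAt).fderiv
    rw [hd]
    refine hf.spacelike u hu _ fun h0 => hw ?_
    have h2 : fderiv ℝ (fun z => F.coords (f (g.symm z))) (F.coords (f u)) w = w := by
      have : (fun z => F.coords (f (g.symm z))) =ᶠ[𝓝 (F.coords (f u))] id :=
        hsec.mono fun z hz => hz.2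
      rw [this.fderiv_eq, fderiv_id]; rfl
    have h3 : fderiv ℝ (fun z => F.coords (f (g.symm z))) (F.coords (f u)) w =
        F.coords (fderiv ℝ (fun z => f (g.symm z)) (F.coords (f u)) w) := by
      have := (F.coords.hasFDerivAt.comp _
        (hsm'.differentiableAt (by simp)).hasFDerivAt).fderiv
      exact congrArg (fun A : E2 →L[ℝ] E2 => A w) this
    rw [← h2, h3, hd]
    exact (congrArg (fun y => F.coords (fderiv ℝ f u y)) h0).trans (by simp)

theorem isLocalHomeomorph_coords (hS : IsSpacelikeSurface S) (F : IsFrame e₁ e₂ p v) :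
    IsLocalHomeomorph fun x : doubleCover S => F.coords x := by
  have hcont : Continuous fun x : doubleCover S => F.coords x :=
    F.coords.continuous.comp continuous_subtype_val
  have hopen : IsOpenMap fun x : doubleCover S => F.coords x := by
    refine IsOpenMap.of_nhds_le fun x V hV => ?_
    obtain ⟨σ, hσ, hσx, hev, -, -⟩ := exists_local_section hS F x.2
    rw [mem_map, nhds_subtype_eq_comap, mem_comap] at hV
    obtain ⟨O, hO, hOV⟩ := hV
    have h := hσ.continuousAt.tendsto
    rw [hσx] at h
    filter_upwards [h.eventually hO, hev] with z hz hz'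
    have := @hOV ⟨σ z, hz'.1⟩ hz
    rwa [mem_preimage, hz'.2] at this
  rw [isLocalHomeomorph_iff_isOpenEmbedding_restrict]
  intro x
  obtain ⟨σ, -, -, -, hinj, -⟩ := exists_local_section hS F x.2
  have hinj' : ∀ᶠ y : doubleCover S in 𝓝 x, σ (F.coords y) = y := by
    rwa [← map_nhds_subtype_val, eventually_map] at hinj
  obtain ⟨V, hV, hVo, hxV⟩ := eventually_nhds_iff.1 hinj'
  refine ⟨V, hVo.mem_nhds hxV, .of_continuous_injective_isOpenMap
    (hcont.comp continuous_subtype_val) ?_ (hopen.domRestrict hVo)⟩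
  intro a b hab
  have hab' : F.coords (a : doubleCover S) = F.coords (b : doubleCover S) := hab
  apply Subtype.ext
  apply Subtype.ext
  rw [← hV _ a.2, ← hV _ b.2, hab']

/-- Closedness of the double cover makes the projection proper, since bounded spacelike coordinates
bound a point of the quadric. A proper local homeomorphism has finite fibres and is a covering. -/
theorem isCoveringMap_coords (hS : IsSpacelikeSurface S)
    (hS' : frontierAtInfinity S ⊆ boundaryAtInfinity) (F : IsFrame e₁ e₂ p v) :
    IsCoveringMap fun x : doubleCover S => F.coords x := by
  have hloc := isLocalHomeomorph_coords hS F
  have hcpt : ∀ K : Set E2, IsCompact K →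
      IsCompact ((fun x : doubleCover S => F.coords x) ⁻¹' K) := by
    intro K hK
    rw [Subtype.isCompact_iff]
    convert F.isCompact_inter (isClosed_doubleCover hS') (doubleCover_subset S) hK using 1
    ext x
    simp [and_comm]
  have hproper : IsProperMap fun x : doubleCover S => F.coords x :=
    isProperMap_iff_isCompact_preimage.2 ⟨hloc.continuous, fun K hK => hcpt K hK⟩
  rw [isCoveringMap_iff_isCoveringMapOn_univ]
  refine hproper.isClosedMap.isCoveringMapOn_of_isLocalHomeomorphOn (fun z _ => ?_)
    (hloc.isLocalHomeomorphOn)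
  refine (hcpt _ isCompact_singleton).finite (.of_openPartialHomeomorph _ subset_rfl fun e _ => ?_)
  obtain ⟨φ, h1, h2⟩ := hloc e
  exact ⟨φ, h1, h2.symm⟩

/-- A smooth global spacelike section of the spacelike coordinates over the double cover. -/
structure IsSection (S : Set RP3) (F : IsFrame e₁ e₂ p v) (s : E2 → R22) : Prop where
  smooth : ContDiff ℝ ∞ s
  mem : ∀ z, s z ∈ doubleCover S
  coords : ∀ z, F.coords (s z) = z
  spacelike : ∀ z w : E2, w ≠ 0 → 0 < form (fderiv ℝ s z w) (fderiv ℝ s z w)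
  eventually : ∀ x ∈ doubleCover S, s (F.coords x) = x →
    ∀ᶠ y in 𝓝[doubleCover S] x, s (F.coords y) = y

/-- The plane is simply connected, so its identity map lifts through the covering. The lift is a
priori only continuous, but agrees locally with the smooth local sections. -/
theorem exists_isSection (hS : IsSpacelikeSurface S)
    (hS' : frontierAtInfinity S ⊆ boundaryAtInfinity) (F : IsFrame e₁ e₂ p v) {x : R22}
    (hx : x ∈ doubleCover S) : ∃ s, IsSection S F s ∧ s (F.coords x) = x := by
  obtain ⟨s, ⟨hs0, hs⟩, -⟩ := (isCoveringMap_coords hS hS' F).existsUnique_continuousMap_lifts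
    (ContinuousMap.id E2) (F.coords x) (⟨x, hx⟩ : doubleCover S) rfl
  have hsc : ∀ z, F.coords (s z) = z := fun z => congrFun hs z
  have hcont : Continuous fun z => (s z : R22) := continuous_subtype_val.comp s.continuous
  have key : ∀ z, ∃ σ : E2 → R22, ContDiffAt ℝ ∞ σ z ∧ (fun z => (s z : R22)) =ᶠ[𝓝 z] σ ∧
      (∀ᶠ y in 𝓝[doubleCover S] (s z : R22), σ (F.coords y) = y) ∧
      ∀ w : E2, w ≠ 0 → 0 < form (fderiv ℝ σ z w) (fderiv ℝ σ z w) := by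
    intro z
    obtain ⟨σ, h1, h2, h3, h4, h5⟩ := exists_local_section hS F (s z).2
    rw [hsc] at h1 h5
    refine ⟨σ, h1, ?_, h4, h5⟩
    have ht : Tendsto (fun z => (s z : R22)) (𝓝 z) (𝓝[doubleCover S] (s z : R22)) :=
      tendsto_nhdsWithin_iff.2 ⟨hcont.tendsto z, Eventually.of_forall fun w => (s w).2⟩
    filter_upwards [ht.eventually h4] with w hw
    rw [← hw, hsc]
  refine ⟨fun z => s z, ⟨contDiff_iff_contDiffAt.2 fun z => ?_, fun z => (s z).2, hsc, ?_, ?_⟩, ?_⟩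
  · obtain ⟨σ, h1, h2, -, -⟩ := key z
    exact h1.congr_of_eventuallyEq h2
  · intro z w hw
    obtain ⟨σ, h1, h2, -, h4⟩ := key z
    rw [h2.fderiv_eq]
    exact h4 w hw
  · intro y hy hsy
    obtain ⟨σ, h1, h2, h3, -⟩ := key (F.coords y)
    rw [hsy] at h3
    have ht : Tendsto F.coords (𝓝[doubleCover S] y) (𝓝 (F.coords y)) :=
      F.coords.continuous.continuousAt.tendsto.mono_left nhdsWithin_le_nhds
    filter_upwards [h3, ht.eventually h2] with w hw hw'
    rw [hw', hw]
  · simp [hs0]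

/-- If `S` is connected, then its double cover is covered by a section and its antipode. -/
theorem IsSection.eq_or_eq_neg {F : IsFrame e₁ e₂ p v} {s : E2 → R22} (hs : IsSection S F s)
    (hS : IsSpacelikeSurface S) (hconn : PreconnectedSpace S) {x : R22}
    (hx : x ∈ doubleCover S) : (∃ z, x = s z) ∨ ∃ z, x = -s z := by
  -- The part of `S` reached by the section is open because `s` is locally inverse to the
  -- coordinates, and closed because being reached amounts to one of two closed equations.
  let A : Set S := {y | ∃ z, proj (s z) (hs.mem z).1 = y}
  have hmem : ∀ y (hy : y ∈ AdSHat), (∃ z, proj (s z) (hs.mem z).1 = proj y hy) ↔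
      s (F.coords y) = y ∨ s (F.coords (-y)) = -y := by
    intro y hy
    constructor
    · rintro ⟨z, hz⟩
      rcases (proj_eq_proj_iff _ _).1 hz with h | h
      · left; rw [← h, hs.coords]
      · right; rw [← h, hs.coords]
    · rintro (h | h)
      · exact ⟨_, (proj_eq_proj_iff _ _).2 (Or.inl h)⟩
      · exact ⟨_, (proj_eq_proj_iff _ _).2 (Or.inr h)⟩
  have hneg : ∀ y, Tendsto (fun y : R22 => -y) (𝓝[doubleCover S] y) (𝓝[doubleCover S] (-y)) :=
    fun y => tendsto_nhdsWithin_iff.2 ⟨(continuous_neg.tendsto y).mono_left nhdsWithin_le_nhds,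
      Eventually.mono self_mem_nhdsWithin fun _ h => neg_mem_doubleCover h⟩
  have hloc : ∀ P : RP3 → Prop, (∀ x ∈ doubleCover S, (∀ hx : x ∈ AdSHat, P (proj x hx)) →
      ∀ᶠ y in 𝓝[doubleCover S] x, ∀ hy : y ∈ AdSHat, P (proj y hy)) →
      IsOpen {y : S | P y} := by
    intro P hP
    rw [isOpen_iff_mem_nhds]
    rintro ⟨y, hyS⟩ hy
    obtain ⟨U, f, hf, u, hu, rfl⟩ := hS y hyS
    have := hf.eventually_proj hu (hP (f u) (hf.mem_doubleCover hu) fun _ => hy)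
    rwa [← map_nhds_subtype_val (⟨_, hyS⟩ : S), eventually_map] at this
  have hA : IsClopen A := by
    refine ⟨⟨?_⟩, ?_⟩
    · refine hloc (fun y => ¬ ∃ z, proj (s z) (hs.mem z).1 = y) fun x hx hPx => ?_
      have hx' := hPx hx.1
      simp only [hmem] at hx' ⊢
      push Not at hx'
      have hc : Continuous fun y => s (F.coords y) := hs.smooth.continuous.comp F.coords.continuous
      have h1 : ∀ᶠ y in 𝓝 x, s (F.coords y) ≠ y :=
        (isClosed_eq hc continuous_id).isOpen_compl.mem_nhds hx'.1
      have h2 : ∀ᶠ y in 𝓝 x, s (F.coords (-y)) ≠ -y :=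
        (isClosed_eq (hc.comp continuous_neg) continuous_neg).isOpen_compl.mem_nhds hx'.2
      filter_upwards [nhdsWithin_le_nhds h1, nhdsWithin_le_nhds h2] with y hy1 hy2 _
      tauto
    · refine hloc (fun y => ∃ z, proj (s z) (hs.mem z).1 = y) fun x hx hPx => ?_
      have hx' := hPx hx.1
      simp only [hmem] at hx' ⊢
      rcases hx' with h | h
      · filter_upwards [hs.eventually x hx h] with y hy _ using Or.inl hy
      · filter_upwards [(hneg x).eventually (hs.eventually _ (neg_mem_doubleCover hx) h)]
          with y hy _ using Or.inr hy
  have huniv : A = univ := hA.eq_univ ⟨⟨proj (s 0) (hs.mem 0).1, (hs.mem 0).2⟩, 0, rfl⟩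
  obtain ⟨z, hz⟩ : (⟨proj x hx.1, hx.2⟩ : S) ∈ A := huniv ▸ mem_univ _
  rcases (proj_eq_proj_iff (hs.mem z).1 hx.1).1 hz with h | h
  · exact Or.inl ⟨z, h.symm⟩
  · exact Or.inr ⟨z, by rw [h, neg_neg]⟩

/-! ### Spacelike curves issuing from a point -/

/-- The timelike coordinates `(X, Y)` of a spacelike curve in the quadric, starting at a base point
and parametrized by its distance from the origin in the spacelike coordinates. -/
structure IsSpacelikeRay (X Y X' Y' : ℝ → ℝ) : Prop where
  hasDerivAt_X : ∀ r, HasDerivAt X (X' r) r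
  hasDerivAt_Y : ∀ r, HasDerivAt Y (Y' r) r
  continuous_X' : Continuous X'
  continuous_Y' : Continuous Y'
  mem : ∀ r, X r ^ 2 + Y r ^ 2 = 1 + r ^ 2
  spacelike : ∀ r, X' r ^ 2 + Y' r ^ 2 < 1
  X_zero : X 0 = 1
  Y_zero : Y 0 = 0

namespace IsSpacelikeRay

variable {X Y X' Y' : ℝ → ℝ}

/-- Along a spacelike curve the polar angle varies slower than the angle of a null curve. -/
theorem exists_angle (h : IsSpacelikeRay X Y X' Y') : ∃ θ : ℝ → ℝ, θ 0 = 0 ∧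
    (∀ r, X r = √(1 + r ^ 2) * Real.cos (θ r)) ∧ StrictMono (fun r => Real.arctan r + θ r) ∧
    StrictMono (fun r => Real.arctan r - θ r) := by
  have cX : Continuous X := continuous_iff_continuousAt.2 fun r => (h.hasDerivAt_X r).continuousAt
  have cY : Continuous Y := continuous_iff_continuousAt.2 fun r => (h.hasDerivAt_Y r).continuousAt
  have cX' := h.continuous_X'
  have cY' := h.continuous_Y'
  have hpos : ∀ r : ℝ, 0 < 1 + r ^ 2 := fun r => by positivity
  -- The angular velocity of `(X, Y)`. Integrating it gives a continuous polar angle directly,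
  -- without choosing branches of an argument.
  let ρ : ℝ → ℝ := fun r => (X r * Y' r - Y r * X' r) / (1 + r ^ 2)
  have cρ : Continuous ρ := by
    refine Continuous.div (by fun_prop) (by fun_prop) fun r => (hpos r).ne'
  let θ : ℝ → ℝ := fun r => ∫ t in (0 : ℝ)..r, ρ t
  have hθ : ∀ r, HasDerivAt θ (ρ r) r := fun r =>
    intervalIntegral.integral_hasDerivAt_right (cρ.intervalIntegrable _ _)
      (cρ.stronglyMeasurableAtFilter _ _) cρ.continuousAt
  have hrad : ∀ r, X r * X' r + Y r * Y' r = r := by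
    intro r
    have h1 : HasDerivAt (fun r => X r ^ 2 + Y r ^ 2)
        (2 * X r * X' r + 2 * Y r * Y' r) r := by
      have := ((h.hasDerivAt_X r).pow 2).add ((h.hasDerivAt_Y r).pow 2)
      refine this.congr_deriv ?_
      norm_num
    have h2 : HasDerivAt (fun r : ℝ => 1 + r ^ 2) (2 * r) r := by
      have := (hasDerivAt_pow 2 r).const_add 1
      refine this.congr_deriv ?_
      norm_num
    have h3 : (fun r => X r ^ 2 + Y r ^ 2) = fun r : ℝ => 1 + r ^ 2 := funext h.mem
    rw [h3] at h1
    linarith [h1.unique h2]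
  -- The velocity has length less than `1` and its radial part is fixed by `X² + Y² = 1 + r²`.
  -- Lagrange's identity leaves less than `1` for `(XY' - YX')²`, and `1 / (1 + r²)` is the
  -- derivative of `arctan`.
  have hρlt : ∀ r, |ρ r| < 1 / (1 + r ^ 2) := by
    intro r
    rw [abs_div, abs_of_pos (hpos r)]
    refine div_lt_div_of_pos_right ?_ (hpos r)
    rw [← sq_lt_one_iff_abs_lt_one]
    have key : (X r * Y' r - Y r * X' r) ^ 2 + (X r * X' r + Y r * Y' r) ^ 2 =
        (X r ^ 2 + Y r ^ 2) * (X' r ^ 2 + Y' r ^ 2) := by ring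
    rw [hrad, h.mem] at key
    nlinarith [h.spacelike r, hpos r]
  have hX' : ∀ r, X' r = r * X r / (1 + r ^ 2) - ρ r * Y r := by
    intro r
    have h1 := h.mem r
    have h2 := hrad r
    have h3 := (hpos r).ne'
    simp only [ρ]
    field_simp
    linear_combination X r * h2 - X' r * h1
  have hY' : ∀ r, Y' r = r * Y r / (1 + r ^ 2) + ρ r * X r := by
    intro r
    have h1 := h.mem r
    have h2 := hrad r
    have h3 := (hpos r).ne'
    simp only [ρ]
    field_simp
    linear_combination Y r * h2 - Y' r * h1
  have hsqrt : ∀ r : ℝ, HasDerivAt (fun r : ℝ => √(1 + r ^ 2)) (r / √(1 + r ^ 2)) r := by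
    intro r
    have h2 : HasDerivAt (fun r : ℝ => 1 + r ^ 2) (2 * r) r := by
      have := (hasDerivAt_pow 2 r).const_add 1
      refine this.congr_deriv ?_
      norm_num
    refine (h2.sqrt (hpos r).ne').congr_deriv ?_
    have := (Real.sqrt_pos.2 (hpos r)).ne'
    field_simp
  have hconst : ∀ (P P' : ℝ → ℝ), (∀ r, HasDerivAt P (P' r) r) →
      (∀ r, P' r = r * P r / (1 + r ^ 2)) → ∀ r, P r = P 0 * √(1 + r ^ 2) := by
    intro P P' hP hP' r
    have hd : ∀ r, HasDerivAt (fun r => P r / √(1 + r ^ 2)) 0 r := by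
      intro r
      have hs := Real.sqrt_pos.2 (hpos r)
      refine ((hP r).div (hsqrt r) hs.ne').congr_deriv ?_
      rw [hP']
      have h3 := (hpos r).ne'
      have h4 := Real.sq_sqrt (hpos r).le
      have h5 := hs.ne'
      field_simp
      rw [h4]
      ring
    have := is_const_of_deriv_eq_zero (f := fun r => P r / √(1 + r ^ 2))
      (fun r => (hd r).differentiableAt) (fun r => (hd r).deriv) r 0
    simp only [ne_eq, OfNat.ofNat_ne_zero, not_false_eq_true, zero_pow, add_zero, Real.sqrt_one,
      div_one] at this
    rw [← this]
    have := (Real.sqrt_pos.2 (hpos r)).ne'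
    field_simp
  have hcos := fun r => (hθ r).cos
  have hsin := fun r => (hθ r).sin
  have hθ0 : θ 0 = 0 := intervalIntegral.integral_same
  -- Rotating `(X, Y)` back by `θ` leaves a vector whose components obey the linear equation solved
  -- by `√(1 + r²)`; the initial values `1` and `0` determine it.
  have hP := hconst (fun r => X r * Real.cos (θ r) + Y r * Real.sin (θ r)) _
    (fun r => ((h.hasDerivAt_X r).mul (hcos r)).add ((h.hasDerivAt_Y r).mul (hsin r))) (by
      intro r; rw [hX', hY']; ring)
  have hQ := hconst (fun r => Y r * Real.cos (θ r) - X r * Real.sin (θ r)) _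
    (fun r => ((h.hasDerivAt_Y r).mul (hcos r)).sub ((h.hasDerivAt_X r).mul (hsin r))) (by
      intro r; rw [hX', hY']; ring)
  simp only [hθ0, h.X_zero, h.Y_zero, Real.cos_zero, Real.sin_zero] at hP hQ
  have hmono : ∀ {f f' : ℝ → ℝ}, (∀ r, HasDerivAt f (f' r) r) → (∀ r, 0 < f' r) → StrictMono f :=
    fun hf hf' => strictMono_of_deriv_pos fun r => by rw [(hf r).deriv]; exact hf' r
  refine ⟨θ, hθ0, fun r => ?_, ?_, ?_⟩
  · linear_combination Real.cos (θ r) * hP r - Real.sin (θ r) * hQ r -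
      X r * Real.sin_sq_add_cos_sq (θ r)
  · refine hmono (fun r => (Real.hasDerivAt_arctan r).add (hθ r)) fun r => ?_
    linarith [(abs_lt.1 (hρlt r)).1]
  · refine hmono (fun r => (Real.hasDerivAt_arctan r).sub (hθ r)) fun r => ?_
    linarith [(abs_lt.1 (hρlt r)).2]

/-- On a null curve `θ = arctan r`, and `√(1 + r²) cos (arctan r) = 1`. A spacelike curve turns
strictly less. -/
theorem one_lt (h : IsSpacelikeRay X Y X' Y') {r : ℝ} (hr : 0 < r) : 1 < X r := by
  obtain ⟨θ, h0, hX, hp, hm⟩ := h.exists_angle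
  have h1 := hp hr
  have h2 := hm hr
  simp only [h0, Real.arctan_zero] at h1 h2
  have hθ : |θ r| < Real.arctan r := abs_lt.2 ⟨by linarith, by linarith⟩
  have hlt := Real.cos_lt_cos_of_nonneg_of_le_pi (abs_nonneg _)
    (by linarith [Real.arctan_lt_pi_div_two r, Real.pi_pos]) hθ
  rw [Real.cos_abs, Real.cos_arctan] at hlt
  have hs : 0 < √(1 + r ^ 2) := Real.sqrt_pos.2 (by positivity)
  rw [hX]
  rwa [div_lt_iff₀' hs] at hlt

end IsSpacelikeRay

/-- A spacelike curve which is uniformly spacelike on its initial segment escapes linearly. -/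
theorem exists_linear_bound {δ : ℝ} (hδ : 0 < δ) : ∃ η > 0, ∀ {X Y X' Y' : ℝ → ℝ},
    IsSpacelikeRay X Y X' Y' → 1 + δ ≤ X 1 → ∀ r, 1 ≤ r → η * r ≤ X r := by
  -- The angle gained at `r = 1` over a null curve, which has angle `π/4` there. The gain persists:
  -- `|θ r| ≤ π/2 - ε` for `r ≥ 1`, whence the slope `sin ε`.
  let ε := Real.pi / 4 - Real.arccos ((1 + δ) / √2)
  have hs2 : (0 : ℝ) < √2 := by positivity
  have harccos : Real.arccos ((1 + δ) / √2) < Real.pi / 4 := by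
    by_contra hcon
    push Not at hcon
    have h1 := Real.cos_le_cos_of_nonneg_of_le_pi (by positivity) (Real.arccos_le_pi _) hcon
    rw [Real.cos_pi_div_four] at h1
    -- Beyond `1`, `Real.arccos` takes the value `0`.
    by_cases hle : (1 + δ) / √2 ≤ 1
    · rw [Real.cos_arccos (by have : 0 < (1 + δ) / √2 := by positivity
                              linarith) hle, div_le_div_iff₀ hs2 (by norm_num)] at h1
      nlinarith [Real.sq_sqrt (show (0 : ℝ) ≤ 2 by norm_num)]
    · rw [Real.arccos_eq_zero.2 (by linarith)] at hcon
      linarith [Real.pi_pos]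
  have hε : 0 < ε := by simp only [ε]; linarith
  have hε' : ε ≤ Real.pi / 4 := by
    simp only [ε]; linarith [Real.arccos_nonneg ((1 + δ) / √2)]
  refine ⟨Real.sin ε, Real.sin_pos_of_pos_of_lt_pi hε (by linarith [Real.pi_pos]), ?_⟩
  intro X Y X' Y' h h1 r hr
  obtain ⟨θ, h0, hX, hp, hm⟩ := h.exists_angle
  have hp1 := hp zero_lt_one
  have hm1 := hm zero_lt_one
  have hpr := hp.monotone hr
  have hmr := hm.monotone hr
  simp only [h0, Real.arctan_zero, Real.arctan_one] at hp1 hm1 hpr hmr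
  have hθ1 : |θ 1| ≤ Real.pi / 4 := abs_le.2 ⟨by linarith, by linarith⟩
  have hcos : (1 + δ) / √2 ≤ Real.cos |θ 1| := by
    rw [hX] at h1
    rw [Real.cos_abs, div_le_iff₀ hs2]
    norm_num at h1
    linarith
  have hθ1' := Real.arccos_le_arccos hcos
  rw [Real.arccos_cos (abs_nonneg _) (by linarith [Real.pi_pos])] at hθ1'
  have hθr : |θ r| ≤ Real.pi / 2 - ε := by
    have := Real.arctan_lt_pi_div_two r
    have := abs_le.1 hθ1'
    simp only [ε]
    exact abs_le.2 ⟨by linarith, by linarith⟩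
  have hc := Real.cos_le_cos_of_nonneg_of_le_pi (abs_nonneg _) (by linarith [Real.pi_pos]) hθr
  rw [Real.cos_abs, Real.cos_pi_div_two_sub] at hc
  have hsq : r ≤ √(1 + r ^ 2) := Real.le_sqrt_of_sq_le (by linarith)
  have hsin : 0 ≤ Real.sin ε := (Real.sin_pos_of_pos_of_lt_pi hε (by linarith [Real.pi_pos])).le
  rw [hX, mul_comm]
  exact mul_le_mul hsq hc hsin (Real.sqrt_nonneg _)

/-! ### Points of the surface are pairwise spacelike separated -/

variable {F : IsFrame e₁ e₂ p v} {s : E2 → R22}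

namespace IsSection

theorem hasFDerivAt (hs : IsSection S F s) (z : E2) : HasFDerivAt s (fderiv ℝ s z) z :=
  (hs.smooth.differentiable (by simp) z).hasFDerivAt

theorem form_self (hs : IsSection S F s) (z : E2) : form (s z) (s z) = -1 := (hs.mem z).1

theorem coords_fderiv (hs : IsSection S F s) (z w : E2) : F.coords (fderiv ℝ s z w) = w := by
  have h : HasFDerivAt (fun z => F.coords (s z)) (F.coords ∘L fderiv ℝ s z) z :=
    F.coords.hasFDerivAt.comp z (hs.hasFDerivAt z)
  rw [funext hs.coords] at h
  exact congrArg (fun A : E2 →L[ℝ] E2 => A w) (h.unique (hasFDerivAt_id z))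

theorem isSpacelikeRay (hs : IsSection S F s) (h0 : s 0 = p) {e : E2} (he : ‖e‖ = 1) :
    IsSpacelikeRay (fun r => -form (s (r • e)) p) (fun r => -form (s (r • e)) v)
      (fun r => -form (fderiv ℝ s (r • e) e) p) (fun r => -form (fderiv ℝ s (r • e) e) v) := by
  have hline : ∀ r : ℝ, HasDerivAt (fun r : ℝ => r • e) e r := fun r => by
    simpa using (hasDerivAt_id r).smul_const e
  have hd : ∀ r : ℝ, HasDerivAt (fun r : ℝ => s (r • e)) (fderiv ℝ s (r • e) e) r := fun r =>
    (hs.hasFDerivAt (r • e)).comp_hasDerivAt r (hline r)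
  have hform : ∀ (y : R22) (r : ℝ), HasDerivAt (fun r : ℝ => -form (s (r • e)) y)
      (-form (fderiv ℝ s (r • e) e) y) r := fun y r =>
    ((formCLM.flip y).hasFDerivAt.comp_hasDerivAt r (hd r)).neg
  have hcd : Continuous fun r : ℝ => fderiv ℝ s (r • e) e := by
    have := hs.smooth.continuous_fderiv (by simp)
    exact (this.comp (by fun_prop : Continuous fun r : ℝ => r • e)).clm_apply continuous_const
  have hc : ∀ y, Continuous fun r : ℝ => -form (fderiv ℝ s (r • e) e) y := fun y =>
    ((formCLM.flip y).continuous.comp hcd).neg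
  refine ⟨hform p, hform v, hc p, hc v, fun r => ?_, fun r => ?_, ?_, ?_⟩
  · have h1 := F.form_eq_norm_coords (s (r • e))
    rw [hs.coords, hs.form_self, norm_smul, he, mul_one, Real.norm_eq_abs, sq_abs] at h1
    linarith
  · have h1 := hs.spacelike (r • e) e (by rintro rfl; simp at he)
    rw [F.form_eq_norm_coords, hs.coords_fderiv, he] at h1
    linarith
  · simp [h0, F.p_p]
  · simp [h0, F.p_v]

theorem one_lt (hs : IsSection S F s) (h0 : s 0 = p) {z : E2} (hz : z ≠ 0) :
    1 < -form (s z) p := by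
  have hn : 0 < ‖z‖ := norm_pos_iff.2 hz
  have h := (hs.isSpacelikeRay h0 (e := ‖z‖⁻¹ • z) (by
    rw [norm_smul, norm_inv, norm_norm, inv_mul_cancel₀ hn.ne'])).one_lt hn
  rwa [smul_inv_smul₀ hn.ne'] at h

/-- Compactness of the unit circle makes the gain at radius `1` uniform over all directions. -/
theorem exists_linear_bound (hs : IsSection S F s) (h0 : s 0 = p) :
    ∃ η > 0, ∀ z : E2, 1 ≤ ‖z‖ → η * ‖z‖ ≤ -form (s z) p := by
  have hc : Continuous fun z => -form (s z) p :=
    ((formCLM.flip p).continuous.comp hs.smooth.continuous).neg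
  obtain ⟨e₀, he₀, hmin⟩ := (isCompact_sphere (0 : E2) 1).exists_isMinOn
    (NormedSpace.sphere_nonempty.2 zero_le_one) hc.continuousOn
  have hne : e₀ ≠ 0 := by rintro rfl; simp at he₀
  obtain ⟨η, hη, h⟩ := AdS.exists_linear_bound (sub_pos.2 (hs.one_lt h0 hne))
  refine ⟨η, hη, fun z hz => ?_⟩
  have hn : 0 < ‖z‖ := by linarith
  have he : ‖‖z‖⁻¹ • z‖ = 1 := by rw [norm_smul, norm_inv, norm_norm, inv_mul_cancel₀ hn.ne']
  have := h (hs.isSpacelikeRay h0 he) (by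
    have := hmin (show ‖z‖⁻¹ • z ∈ Metric.sphere (0 : E2) 1 by simpa using he)
    simp only [mem_ofPred_eq] at this
    simpa using this) ‖z‖ hz
  rwa [smul_inv_smul₀ hn.ne'] at this

end IsSection

/-- Every point of the quadric is part of a frame. -/
theorem exists_isFrame_of_mem {q : R22} (hq : form q q = -1) :
    ∃ e₁ e₂ v : R22, IsFrame e₁ e₂ q v := by
  -- Multiplication by `i` on `ℝ⁴ = ℂ²`: it preserves the form and sends `q` to an orthogonal
  -- vector.
  let v : R22 := ![-q 1, q 0, -q 3, q 2]
  have hv : form v v = -1 := by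
    rw [← hq]; simp [form, v]; ring
  have hqv : form q v = 0 := by simp [form, v]; ring
  obtain ⟨e₁, e₂, F⟩ := exists_isFrame hq hv hqv
  exact ⟨e₁, e₂, v, F⟩

theorem exists_centered_section (hS : IsSpacelikeSurface S)
    (hS' : frontierAtInfinity S ⊆ boundaryAtInfinity) {q : R22} (hq : q ∈ doubleCover S) :
    ∃ (e₁ e₂ v : R22) (F : IsFrame e₁ e₂ q v) (s : E2 → R22), IsSection S F s ∧ s 0 = q := by
  obtain ⟨e₁, e₂, v, F⟩ := exists_isFrame_of_mem hq.1
  obtain ⟨s, hs, h⟩ := exists_isSection hS hS' F hq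
  rw [F.coords_p] at h
  exact ⟨e₁, e₂, v, F, s, hs, h⟩

theorem one_le_abs_form (hS : IsSpacelikeSurface S)
    (hS' : frontierAtInfinity S ⊆ boundaryAtInfinity) (hconn : PreconnectedSpace S) {x q : R22}
    (hx : x ∈ doubleCover S) (hq : q ∈ doubleCover S) : 1 ≤ |form x q| := by
  obtain ⟨e₁, e₂, v, F, s, hs, h0⟩ := exists_centered_section hS hS' hq
  have key : ∀ z, 1 ≤ -form (s z) q := by
    intro z
    by_cases hz : z = 0
    · rw [hz, h0, F.p_p]; norm_num
    · exact (hs.one_lt h0 hz).le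
  rcases hs.eq_or_eq_neg hS hconn hx with ⟨z, rfl⟩ | ⟨z, rfl⟩
  · exact (key z).trans (neg_le_abs _)
  · rw [form_neg_left, abs_neg]
    exact (key z).trans (neg_le_abs _)

/-- Linear growth of `|⟨x, q⟩|` bounds the spacelike coordinates. This supplies the maximum used in
`IsSection.abs_form_normal_le` on a noncompact surface. -/
theorem isCompact_abs_form_le (hS : IsSpacelikeSurface S)
    (hS' : frontierAtInfinity S ⊆ boundaryAtInfinity) (hconn : PreconnectedSpace S) {q : R22}
    (hq : q ∈ doubleCover S) (c : ℝ) : IsCompact {x | x ∈ doubleCover S ∧ |form x q| ≤ c} := by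
  obtain ⟨e₁, e₂, v, F, s, hs, h0⟩ := exists_centered_section hS hS' hq
  obtain ⟨η, hη, hbound⟩ := hs.exists_linear_bound h0
  have hcl : IsClosed {x | x ∈ doubleCover S ∧ |form x q| ≤ c} :=
    (isClosed_doubleCover hS').inter
      (isClosed_le (formCLM.flip q).continuous.abs continuous_const)
  refine (F.isCompact_inter (isClosed_doubleCover hS') (doubleCover_subset S)
    (isCompact_closedBall (0 : E2) (max 1 (c / η)))).of_isClosed_subset hcl ?_
  rintro x ⟨hx, hxc⟩
  have key : ∀ z, |form (s z) q| ≤ c → ‖z‖ ≤ max 1 (c / η) := by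
    intro z hz
    rcases le_or_gt ‖z‖ 1 with h | h
    · exact h.trans (le_max_left _ _)
    · refine le_trans ?_ (le_max_right _ _)
      rw [le_div_iff₀' hη]
      exact ((hbound z h.le).trans (neg_le_abs _)).trans hz
  refine ⟨hx, ?_⟩
  rw [mem_preimage, mem_closedBall_zero_iff]
  rcases hs.eq_or_eq_neg hS hconn hx with ⟨z, rfl⟩ | ⟨z, rfl⟩
  · rw [hs.coords]
    exact key z hxc
  · rw [map_neg, norm_neg, hs.coords]
    rw [form_neg_left, abs_neg] at hxc
    exact key z hxc

/-! ### The shape operator of a global section -/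

variable {N : E2 → R22}

theorem hasFDerivAt_form {f g : E2 → R22} {f' g' : E2 →L[ℝ] R22} {z : E2}
    (hf : HasFDerivAt f f' z) (hg : HasFDerivAt g g' z) :
    ∃ A : E2 →L[ℝ] ℝ, HasFDerivAt (fun z => form (f z) (g z)) A z ∧
      ∀ w, A w = form (f z) (g' w) + form (f' w) (g z) :=
  ⟨_, formCLM.hasFDerivAt_of_bilinear hf hg, fun w => by simp⟩

/-- Leibniz rule for two fields along a surface whose product is constant. -/
theorem form_add_form_eq_zero {f g : E2 → R22} {f' g' : E2 →L[ℝ] R22} {z : E2} {c : ℝ}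
    (hf : HasFDerivAt f f' z) (hg : HasFDerivAt g g' z) (h : ∀ z, form (f z) (g z) = c) (w : E2) :
    form (f z) (g' w) + form (f' w) (g z) = 0 := by
  obtain ⟨A, hA, hA'⟩ := hasFDerivAt_form hf hg
  rw [funext h] at hA
  rw [← hA', hA.unique (hasFDerivAt_const c z)]
  rfl

namespace IsSection

theorem form_fderiv (hs : IsSection S F s) (z w : E2) : form (s z) (fderiv ℝ s z w) = 0 := by
  have := form_add_form_eq_zero (hs.hasFDerivAt z) (hs.hasFDerivAt z) hs.form_self w
  rw [form_comm (fderiv ℝ s z w)] at this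
  linarith

/-- Principal curvatures are defined through patches, so the global graph has to be one. With `p` on
the surface, `⟨s z, p⟩ < 0` everywhere, which separates `s` from `-s` and makes the projection
injective. -/
theorem isSpacelikePatch (hs : IsSection S F s) (h0 : s 0 = p) (hS : IsSpacelikeSurface S)
    (hconn : PreconnectedSpace S) : IsSpacelikePatch S univ s := by
  have hneg : ∀ z, form (s z) p < 0 := by
    intro z
    by_cases hz : z = 0
    · rw [hz, h0, F.p_p]; norm_num
    · linarith [hs.one_lt h0 hz]
  have hinj : ∀ {z y} (hy : y ∈ AdSHat), proj (s z) (hs.mem z).1 = proj y hy → form y p < 0 →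
      s z = y := by
    intro z y hy h hyp
    rcases (proj_eq_proj_iff (hs.mem z).1 hy).1 h with h | h
    · exact h
    · have := hneg z
      rw [h, form_neg_left] at this
      linarith
  refine ⟨isOpen_univ, hs.smooth.contDiffOn, fun z _ => (hs.mem z).1, fun z _ => hs.spacelike z,
    ⟨isInducing_iff_nhds.2 fun z => le_antisymm ?_ ?_, ?_⟩, univ, isOpen_univ, ?_⟩
  · refine Continuous.tendsto (f := fun u : (univ : Set E2) => proj (s u) (hs.mem u).1) ?_ z
      |>.le_comap
    exact isQuotientMap_mk.continuous.comp
      (f := fun u : (univ : Set E2) => (⟨s u, ne_zero_of_mem_AdSHat (hs.mem u).1⟩ :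
        {x : R22 // x ≠ 0}))
      ((hs.smooth.continuous.comp continuous_subtype_val).subtype_mk _)
  · intro V hV
    rw [mem_nhds_subtype] at hV
    obtain ⟨V', hV', hVV'⟩ := hV
    obtain ⟨U, f, hf, u, hu, hfu⟩ := exists_patch hS (hs.mem z)
    have hev : ∀ᶠ y in 𝓝[doubleCover S] f u, ∀ hy : y ∈ AdSHat,
        ∀ z', proj (s z') (hs.mem z').1 = proj y hy → z' ∈ V' := by
      rw [hfu]
      have h1 : ∀ᶠ y in 𝓝 (s z), form y p < 0 :=
        (formCLM.flip p).continuous.continuousAt.eventually_lt continuousAt_const (hneg z)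
      have h2 : ∀ᶠ y in 𝓝 (s z), F.coords y ∈ V' :=
        F.coords.continuous.continuousAt (by rwa [hs.coords])
      filter_upwards [nhdsWithin_le_nhds h1, nhdsWithin_le_nhds h2] with y hy1 hy2 hy z' hz'
      rwa [← hinj hy hz' hy1, hs.coords] at hy2
    have h := hf.eventually_proj hu (P := fun y => ∀ z', proj (s z') (hs.mem z').1 = y → z' ∈ V')
      hev
    simp only [hfu] at h
    rw [eventually_nhdsWithin_iff] at h
    exact ⟨_, h, fun z' hz' => hVV' (hz' (hs.mem z').2 z' rfl)⟩
  · intro z z' h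
    apply Subtype.ext
    rw [← hs.coords z, hinj (hs.mem z').1 h (hneg z'), hs.coords]
  · rw [inter_univ]
    refine Subset.antisymm ?_ fun y hy => ?_
    · rintro _ ⟨z, rfl⟩
      exact (hs.mem z).2
    · obtain ⟨U, f, hf, u, hu, rfl⟩ := hS y hy
      rcases hs.eq_or_eq_neg hS hconn (hf.mem_doubleCover hu) with ⟨z, h⟩ | ⟨z, h⟩
      · exact ⟨⟨z, mem_univ z⟩, (proj_eq_proj_iff _ _).2 (Or.inl h.symm)⟩
      · exact ⟨⟨z, mem_univ z⟩, (proj_eq_proj_iff _ _).2 (Or.inr (by rw [h, neg_neg]))⟩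

end IsSection

theorem contDiff_cross {f g h : E2 → R22} (hf : ContDiff ℝ ∞ f) (hg : ContDiff ℝ ∞ g)
    (hh : ContDiff ℝ ∞ h) : ContDiff ℝ ∞ fun z => cross (f z) (g z) (h z) := by
  have hf' := fun i => contDiff_pi.1 hf i
  have hg' := fun i => contDiff_pi.1 hg i
  have hh' := fun i => contDiff_pi.1 hh i
  rw [contDiff_pi]
  intro i
  fin_cases i <;> simp [cross] <;> fun_prop

theorem contDiff_form {f g : E2 → R22} (hf : ContDiff ℝ ∞ f) (hg : ContDiff ℝ ∞ g) :
    ContDiff ℝ ∞ fun z => form (f z) (g z) := by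
  have hf' := fun i => contDiff_pi.1 hf i
  have hg' := fun i => contDiff_pi.1 hg i
  unfold form
  fun_prop

theorem IsSection.exists_isUnitNormal (hs : IsSection S F s) :
    ∃ N, IsUnitNormal univ s N := by
  let a : E2 := EuclideanSpace.single 0 1
  let b : E2 := EuclideanSpace.single 1 1
  have hab : ∀ w : E2, w = w 0 • a + w 1 • b := by
    intro w; ext i; fin_cases i <;> simp [a, b]
  have ha : a ≠ 0 := fun h => by simpa [a] using congrArg (fun w : E2 => w 0) h
  have hb : b ≠ 0 := fun h => by simpa [b] using congrArg (fun w : E2 => w 1) h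
  let c : E2 → R22 := fun z => cross (s z) (fderiv ℝ s z a) (fderiv ℝ s z b)
  have hd : ∀ w, ContDiff ℝ ∞ fun z => fderiv ℝ s z w := fun w =>
    (hs.smooth.fderiv_right (m := ∞) (by simp)).clm_apply contDiff_const
  have hc : ContDiff ℝ ∞ c := contDiff_cross hs.smooth (hd a) (hd b)
  have hneg : ∀ z, 0 < -form (c z) (c z) := by
    intro z
    -- Cauchy–Schwarz for the first fundamental form: the square of `⟨b,b⟩ a - ⟨a,b⟩ b` is `⟨b,b⟩`
    -- times the Gram determinant of the two tangent vectors. Since `s z` is orthogonal to both and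
    -- has square `-1`, their cross product with it is timelike.
    have hG := hs.spacelike z b hb
    have hw : form (fderiv ℝ s z b) (fderiv ℝ s z b) • a -
        form (fderiv ℝ s z a) (fderiv ℝ s z b) • b ≠ 0 := by
      intro h
      have := congrArg (fun w : E2 => w 0) h
      simp [a, b] at this
      linarith
    have h1 := hs.spacelike z _ hw
    simp only [map_sub, map_smul, form_sub_left, form_sub_right, form_smul_left,
      form_smul_right, form_comm (fderiv ℝ s z b) (fderiv ℝ s z a)] at h1
    rw [form_cross_self, hs.form_self, hs.form_fderiv, hs.form_fderiv]
    have h2 : 0 < form (fderiv ℝ s z b) (fderiv ℝ s z b) *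
        (form (fderiv ℝ s z a) (fderiv ℝ s z a) * form (fderiv ℝ s z b) (fderiv ℝ s z b) -
          form (fderiv ℝ s z a) (fderiv ℝ s z b) ^ 2) := by
      linarith
    linarith [(mul_pos_iff_of_pos_left hG).1 h2]
  have hsq : ∀ z, √(-form (c z) (c z)) ≠ 0 := fun z => (Real.sqrt_pos.2 (hneg z)).ne'
  refine ⟨fun z => (√(-form (c z) (c z)))⁻¹ • c z, ContDiff.contDiffOn ?_, fun z _ => ?_,
    fun z _ => ?_, fun z _ w => ?_⟩
  · exact (((contDiff_form hc hc).neg.sqrt fun z => (hneg z).ne').inv hsq).smul hc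
  · have h := Real.sq_sqrt (hneg z).le
    have h' := hsq z
    simp only [form_smul_left, form_smul_right]
    field_simp
    linarith
  · rw [form_smul_left, form_cross_first, mul_zero]
  · rw [form_smul_left, hab w, map_add, map_smul, map_smul, form_add_right, form_smul_right,
      form_smul_right, form_cross_second, form_cross_third]
    ring

/-- The eigenvector of a symmetric bilinear form, relative to a positive definite one, with the
largest eigenvalue. -/
theorem exists_max_eigenvector (b g : E2 →L[ℝ] E2 →L[ℝ] ℝ) (hb : ∀ x y, b x y = b y x)
    (hg : ∀ x y, g x y = g y x) (hpos : ∀ x, x ≠ 0 → 0 < g x x) :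
    ∃ (k : ℝ) (x : E2), x ≠ 0 ∧ (∀ y, b x y = k * g x y) ∧ ∀ y, b y y ≤ k * g y y := by
  have hcb : Continuous fun x => b x x := by fun_prop
  have hcg : Continuous fun x => g x x := by fun_prop
  have hne : ∀ x ∈ Metric.sphere (0 : E2) 1, x ≠ 0 := by
    rintro x hx rfl; simp at hx
  obtain ⟨x, hx, hmax⟩ := (isCompact_sphere (0 : E2) 1).exists_isMaxOn
    (NormedSpace.sphere_nonempty.2 zero_le_one)
    (f := fun x => b x x / g x x)
    (hcb.continuousOn.div hcg.continuousOn fun x hx => (hpos x (hne x hx)).ne')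
  have hgx := hpos x (hne x hx)
  let k := b x x / g x x
  have hle : ∀ y, b y y ≤ k * g y y := by
    intro y
    by_cases hy : y = 0
    · simp [hy]
    have hn : 0 < ‖y‖ := norm_pos_iff.2 hy
    have h1 := hmax (show ‖y‖⁻¹ • y ∈ Metric.sphere (0 : E2) 1 by
      rw [mem_sphere_zero_iff_norm, norm_smul, norm_inv, norm_norm, inv_mul_cancel₀ hn.ne'])
    have h2 : b (‖y‖⁻¹ • y) (‖y‖⁻¹ • y) / g (‖y‖⁻¹ • y) (‖y‖⁻¹ • y) = b y y / g y y := by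
      have := (hpos y hy).ne'
      simp only [map_smul, smul_apply, smul_eq_mul]
      field_simp
    simp only [mem_ofPred_eq, h2] at h1
    exact (div_le_iff₀ (hpos y hy)).1 h1
  refine ⟨k, x, hne x hx, fun y => ?_, hle⟩
  have hk : b x x = k * g x x := by simp only [k]; field_simp
  -- The form `k g - b` is positive semidefinite and vanishes at `x`. The constant term of this
  -- quadratic is thus `0`, and the discriminant kills its linear term, giving the eigenvector
  -- equation.
  have hquad : ∀ t : ℝ, 0 ≤ (k * g y y - b y y) * (t * t) + (2 * (k * g x y - b x y)) * t + 0 := by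
    intro t
    have := hle (x + t • y)
    simp only [map_add, map_smul, add_apply, smul_apply,
      smul_eq_mul, hb y x, hg y x] at this
    linarith
  have := discrim_le_zero hquad
  simp only [discrim, mul_zero, sub_zero] at this
  nlinarith

namespace IsSection

theorem hasFDerivAt_normal (hN : IsUnitNormal univ s N) (z : E2) :
    HasFDerivAt N (fderiv ℝ N z) z :=
  ((contDiffOn_univ.1 hN.smooth).differentiable (by simp) z).hasFDerivAt

/-- Vectors orthogonal to the position and the normal vectors are tangent to the surface. -/
theorem fderiv_coords (hs : IsSection S F s) (hN : IsUnitNormal univ s N) {z : E2} {y : R22}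
    (hys : form y (s z) = 0) (hyN : form y (N z) = 0) : fderiv ℝ s z (F.coords y) = y := by
  obtain ⟨_, _, G⟩ := exists_isFrame (hs.form_self z) (hN.unit z (mem_univ z))
    (by rw [form_comm]; exact hN.tangent z (mem_univ z))
  rw [eq_comm, ← sub_eq_zero]
  refine G.eq_zero_of_form_nonpos ?_ ?_ ?_
  · rw [form_sub_left, hys, form_comm, hs.form_fderiv, sub_zero]
  · rw [form_sub_left, hyN, form_comm, hN.normal z (mem_univ z), sub_zero]
  · rw [F.form_eq_norm_coords, map_sub, hs.coords_fderiv, sub_self, norm_zero]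
    nlinarith [sq_nonneg (form (y - fderiv ℝ s z (F.coords y)) p),
      sq_nonneg (form (y - fderiv ℝ s z (F.coords y)) v)]

theorem form_fderiv_normal (hs : IsSection S F s) (hN : IsUnitNormal univ s N) (z w : E2) :
    form (fderiv ℝ N z w) (s z) = 0 := by
  have := form_add_form_eq_zero (hasFDerivAt_normal hN z) (hs.hasFDerivAt z)
    (fun z => hN.tangent z (mem_univ z)) w
  rwa [hN.normal z (mem_univ z), zero_add] at this

theorem form_fderiv_normal_normal (hN : IsUnitNormal univ s N) (z w : E2) :
    form (fderiv ℝ N z w) (N z) = 0 := by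
  have := form_add_form_eq_zero (hasFDerivAt_normal hN z) (hasFDerivAt_normal hN z)
    (fun z => hN.unit z (mem_univ z)) w
  rw [form_comm (N z)] at this
  linarith

/-- The flat derivative of `N` is already tangent to the surface, and the coordinates of the frame
invert the differential of `s` on tangent vectors. -/
theorem isShapeOperator (hs : IsSection S F s) (hN : IsUnitNormal univ s N) (z : E2) :
    IsShapeOperator s N z (F.coords ∘L fderiv ℝ N z).toLinearMap := by
  intro w
  rw [covDeriv, form_fderiv_normal hs hN, zero_smul, add_zero]
  exact hs.fderiv_coords hN (form_fderiv_normal hs hN z w) (form_fderiv_normal_normal hN z w)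

/-- Differentiating `⟨N, ds w'⟩ = 0` expresses it through the second derivative of `s`, which is
symmetric. -/
theorem secondFundamentalForm_symm (hs : IsSection S F s) (hN : IsUnitNormal univ s N)
    (z w w' : E2) :
    form (fderiv ℝ N z w) (fderiv ℝ s z w') = form (fderiv ℝ N z w') (fderiv ℝ s z w) := by
  have hd : HasFDerivAt (fderiv ℝ s) (fderiv ℝ (fderiv ℝ s) z) z :=
    ((hs.smooth.fderiv_right (m := ∞) (by simp)).differentiable (by simp) z).hasFDerivAt
  have key : ∀ w w', form (N z) (fderiv ℝ (fderiv ℝ s) z w w') +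
      form (fderiv ℝ N z w) (fderiv ℝ s z w') = 0 := by
    intro w w'
    have h : HasFDerivAt (fun z => fderiv ℝ s z w')
        ((ContinuousLinearMap.apply ℝ R22 w') ∘L fderiv ℝ (fderiv ℝ s) z) z :=
      (ContinuousLinearMap.apply ℝ R22 w').hasFDerivAt.comp z hd
    exact form_add_form_eq_zero (hasFDerivAt_normal hN z) h
      (fun z => hN.normal z (mem_univ z) w') w
  have hsymm : fderiv ℝ (fderiv ℝ s) z w w' = fderiv ℝ (fderiv ℝ s) z w' w :=
    (hs.smooth.contDiffAt.isSymmSndFDerivAt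
      (by rw [minSmoothness_of_isRCLikeNormedField]
          exact WithTop.coe_le_coe.2 (le_top : (2 : ℕ∞) ≤ ⊤))).eq w w'
  have h1 := key w w'
  have h2 := key w' w
  rw [hsymm] at h1
  linarith

/-- The extreme values of the second fundamental form relative to the first are eigenvalues of the
shape operator; the lower one comes from applying `exists_max_eigenvector` to `-b`. -/
theorem abs_secondFundamentalForm_le (hs : IsSection S F s) (h0 : s 0 = p)
    (hS : IsSpacelikeSurface S) (hconn : PreconnectedSpace S) (hcurv : curvatureNorm S < 1)
    (hN : IsUnitNormal univ s N) (z w : E2) :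
    |form (fderiv ℝ N z w) (fderiv ℝ s z w)| ≤
      (curvatureNorm S).toReal * form (fderiv ℝ s z w) (fderiv ℝ s z w) := by
  let b : E2 →L[ℝ] E2 →L[ℝ] ℝ := formCLM.bilinearComp (fderiv ℝ N z) (fderiv ℝ s z)
  let g : E2 →L[ℝ] E2 →L[ℝ] ℝ := formCLM.bilinearComp (fderiv ℝ s z) (fderiv ℝ s z)
  have hb : ∀ x y, b x y = form (fderiv ℝ N z x) (fderiv ℝ s z y) := fun x y => rfl
  have hg : ∀ x y, g x y = form (fderiv ℝ s z x) (fderiv ℝ s z y) := fun x y => rfl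
  have hbs : ∀ x y, b x y = b y x := hs.secondFundamentalForm_symm hN z
  have hgs : ∀ x y, g x y = g y x := fun x y => form_comm _ _
  have hgp : ∀ x, x ≠ 0 → 0 < g x x := hs.spacelike z
  have hB := hs.isShapeOperator hN z
  have heig : ∀ (k : ℝ) (x : E2), x ≠ 0 → (∀ y, b x y = k * g x y) →
      |k| ≤ (curvatureNorm S).toReal := by
    intro k x hx hk
    have hBx : (F.coords ∘L fderiv ℝ N z).toLinearMap x = k • x := by
      rw [← sub_eq_zero]
      by_contra hne
      refine (hgp _ hne).ne' ?_
      have hd : fderiv ℝ s z ((F.coords ∘L fderiv ℝ N z).toLinearMap x - k • x) =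
          fderiv ℝ N z x - k • fderiv ℝ s z x := by
        rw [map_sub, hB, covDeriv, form_fderiv_normal hs hN, zero_smul, add_zero, map_smul]
      rw [hg]
      nth_rewrite 1 [hd]
      rw [form_sub_left, form_smul_left, ← hb, ← hg, hk, sub_self]
    have hpc : IsPrincipalCurvature S k :=
      ⟨univ, s, N, z, _, hs.isSpacelikePatch h0 hS hconn, hN, mem_univ z, hB,
        Module.End.hasEigenvalue_of_hasEigenvector
          ⟨Module.End.mem_eigenspace_iff.2 hBx, hx⟩⟩
    rw [← ENNReal.ofReal_le_iff_le_toReal (ne_top_of_lt hcurv)]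
    exact le_iSup₂_of_le k hpc le_rfl
  have hgw : 0 ≤ g w w := by
    by_cases hw : w = 0
    · simp [hw]
    · exact (hgp w hw).le
  obtain ⟨k, x, hx, hk, hle⟩ := exists_max_eigenvector b g hbs hgs hgp
  obtain ⟨k', x', hx', hk', hle'⟩ := exists_max_eigenvector (-b) g
    (fun x y => congrArg Neg.neg (hbs x y)) hgs hgp
  have h1 := heig k x hx hk
  have h2 := heig (-k') x' hx' (fun y => by
    have := hk' y
    simp only [neg_apply] at this
    linarith)
  have h3 := hle w
  have h4 := hle' w
  simp only [neg_apply] at h4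
  rw [abs_neg] at h2
  rw [← hb, ← hg]
  exact abs_le.2 ⟨by nlinarith [le_abs_self k'], by nlinarith [le_abs_self k]⟩

end IsSection

/-! ### Global comparison of the surface with its tangent planes -/

theorem eventually_lt_of_hasDerivAt_pos {f : ℝ → ℝ} {f' : ℝ} (hf : HasDerivAt f f' 0)
    (hf' : 0 < f') : ∀ᶠ t in 𝓝[>] (0 : ℝ), f 0 < f t := by
  have h := hf.tendsto_slope_zero_right.eventually (lt_mem_nhds hf')
  filter_upwards [h, self_mem_nhdsWithin] with t ht htpos
  have htpos' : 0 < t := htpos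
  rw [zero_add, smul_eq_mul] at ht
  linarith [(mul_pos_iff_of_pos_left (inv_pos.2 htpos')).1 ht]

theorem exists_sign_mul_eq_abs (x : ℝ) : ∃ a : ℝ, a ^ 2 = 1 ∧ a * x = |x| := by
  rcases abs_cases x with ⟨h, -⟩ | ⟨h, -⟩
  · exact ⟨1, by norm_num, by rw [h, one_mul]⟩
  · exact ⟨-1, by norm_num, by rw [h]; ring⟩

theorem mul_le_abs_of_sq_eq_one {a : ℝ} (ha : a ^ 2 = 1) (x : ℝ) : a * x ≤ |x| := by
  rcases sq_eq_one_iff.1 ha with rfl | rfl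
  · simpa using le_abs_self x
  · simpa using neg_le_abs x

namespace IsSection

/-- The tangential part of a vector. -/
theorem fderiv_coords_tangential (hs : IsSection S F s) (hN : IsUnitNormal univ s N) (z : E2)
    (q : R22) : fderiv ℝ s z (F.coords (q + form (s z) q • s z + form (N z) q • N z)) =
      q + form (s z) q • s z + form (N z) q • N z := by
  have h1 := hs.form_self z
  have h2 := hN.unit z (mem_univ z)
  have h3 := hN.tangent z (mem_univ z)
  refine hs.fderiv_coords hN ?_ ?_
  · simp only [form_add_left, form_smul_left, h1, h3, form_comm q]; ring
  · simp only [form_add_left, form_smul_left, h2, form_comm (s z) (N z), h3, form_comm q]; ring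

theorem form_tangential (s N : E2 → R22) (z : E2) (q : R22) :
    form (q + form (s z) q • s z + form (N z) q • N z) q =
      form q q + form (s z) q ^ 2 + form (N z) q ^ 2 := by
  simp only [form_add_left, form_smul_left]; ring

theorem form_tangential_self (hs : IsSection S F s) (hN : IsUnitNormal univ s N) (z : E2)
    (q : R22) : form (q + form (s z) q • s z + form (N z) q • N z)
      (q + form (s z) q • s z + form (N z) q • N z) =
      form q q + form (s z) q ^ 2 + form (N z) q ^ 2 := by
  have h1 := hs.form_self z
  have h2 := hN.unit z (mem_univ z)
  have h3 := hN.tangent z (mem_univ z)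
  simp only [form_add_left, form_smul_left, form_add_right, form_smul_right, h1, h2, h3,
    form_comm (s z) (N z), form_comm q]
  ring

/-- The tangential part of `q` has square `-1 + ⟨s z, q⟩² + ⟨N z, q⟩²`, nonnegative since the
tangent plane is spacelike. -/
theorem one_le_sq_add_sq (hs : IsSection S F s) (hN : IsUnitNormal univ s N) (z : E2) {q : R22}
    (hq : form q q = -1) : 1 ≤ form (s z) q ^ 2 + form (N z) q ^ 2 := by
  have h := hs.form_tangential_self hN z q
  rw [← hs.fderiv_coords_tangential hN z q, hq] at h
  by_cases hw : F.coords (q + form (s z) q • s z + form (N z) q • N z) = 0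
  · rw [hw, map_zero, form_zero_left] at h
    linarith
  · linarith [hs.spacelike z _ hw]

theorem continuous_normal (hN : IsUnitNormal univ s N) : Continuous N :=
  (contDiffOn_univ.1 hN.smooth).continuous

/-- Maximize `|v| - k|u|` on the compact set where `|u|` is at most its value at `z₀`. If `τ ≠ 0` at
the maximum, moving along `∓τ` so as to decrease `|u|` stays in the set and increases the function,
because `|v|` falls at a rate at most `K⟨τ, τ⟩` while `k|u|` falls at rate `k⟨τ, τ⟩`, with `k > K`.
-/
theorem abs_form_normal_le (hs : IsSection S F s) (h0 : s 0 = p)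
    (hS : IsSpacelikeSurface S) (hS' : frontierAtInfinity S ⊆ boundaryAtInfinity)
    (hconn : PreconnectedSpace S) (hcurv : curvatureNorm S < 1) (hN : IsUnitNormal univ s N)
    {k : ℝ} (hk : (curvatureNorm S).toReal < k) {q : R22} (hq : q ∈ doubleCover S) (z₀ : E2) :
    |form (N z₀) q| ≤ k * |form (s z₀) q| := by
  have hk0 : 0 < k := ENNReal.toReal_nonneg.trans_lt hk
  have hcu : Continuous fun z => form (s z) q :=
    (formCLM.flip q).continuous.comp hs.smooth.continuous
  have hcv : Continuous fun z => form (N z) q :=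
    (formCLM.flip q).continuous.comp (continuous_normal hN)
  let C : Set E2 := {z | |form (s z) q| ≤ |form (s z₀) q|}
  have hC : IsCompact C := by
    refine ((isCompact_abs_form_le hS hS' hconn hq |form (s z₀) q|).image
      F.coords.continuous).of_isClosed_subset (isClosed_le hcu.abs continuous_const) fun z hz => ?_
    exact ⟨s z, ⟨hs.mem z, hz⟩, hs.coords z⟩
  have hz₀ : z₀ ∈ C := le_refl |form (s z₀) q|
  obtain ⟨z, hz, hmax⟩ := hC.exists_isMaxOn ⟨z₀, hz₀⟩
    (f := fun z => |form (N z) q| - k * |form (s z) q|)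
    (hcv.abs.sub (continuous_const.mul hcu.abs)).continuousOn
  suffices h : |form (N z) q| - k * |form (s z) q| ≤ 0 by
    have := hmax hz₀
    simp only [mem_ofPred_eq] at this
    linarith
  have hu1 := one_le_abs_form hS hS' hconn (hs.mem z) hq
  have hqq : form q q = -1 := hq.1
  set t := q + form (s z) q • s z + form (N z) q • N z with ht
  set w := F.coords t with hw
  have hwt : fderiv ℝ s z w = t := hs.fderiv_coords_tangential hN z q
  have htq : form t q = -1 + form (s z) q ^ 2 + form (N z) q ^ 2 := by
    rw [ht, form_tangential, hqq]
  have htt : form t t = form t q := by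
    rw [htq, ht, hs.form_tangential_self hN, hqq]
  -- Here `form t q = ⟨t, t⟩ = u² + v² - 1`. If it is not positive, `|u| ≥ 1` gives `v = 0`.
  rcases le_or_gt (form t q) 0 with hτ | hτ
  · have : form (N z) q = 0 := by
      rw [htq] at hτ
      have := one_le_sq_iff_one_le_abs _ |>.2 hu1
      nlinarith [sq_nonneg (form (N z) q)]
    rw [this, abs_zero]
    nlinarith
  exfalso
  obtain ⟨a, ha, hau⟩ := exists_sign_mul_eq_abs (form (s z) q)
  obtain ⟨b, hb, hbv⟩ := exists_sign_mul_eq_abs (form (N z) q)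
  have hII := hs.abs_secondFundamentalForm_le h0 hS hconn hcurv hN z w
  rw [hwt, htt] at hII
  have hNq : form (fderiv ℝ N z w) q = form (fderiv ℝ N z w) t := by
    rw [ht, form_add_right, form_add_right, form_smul_right, form_smul_right,
      form_fderiv_normal hs hN, form_fderiv_normal_normal hN]
    ring
  -- The signs `a` and `b` linearize the absolute values: `a u = |u|` near `z`, while `b v ≤ |v|`
  -- everywhere with equality at `z`, which suffices even if `v` vanishes.
  have hline : HasDerivAt (fun r : ℝ => z + r • (-a • w)) (-a • w) 0 := by
    simpa using ((hasDerivAt_id (0 : ℝ)).smul_const (-a • w)).const_add z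
  have hz0 : z + (0 : ℝ) • (-a • w) = z := by simp
  have hdu : HasDerivAt (fun r : ℝ => form (s (z + r • (-a • w))) q) (-a * form t q) 0 := by
    have h1 : HasFDerivAt s (fderiv ℝ s z) (z + (0 : ℝ) • (-a • w)) := by
      rw [hz0]; exact hs.hasFDerivAt z
    refine ((formCLM.flip q).hasFDerivAt.comp_hasDerivAt (0 : ℝ)
      (h1.comp_hasDerivAt (0 : ℝ) hline)).congr_deriv ?_
    rw [map_smul, hwt]
    simp
  have hdv : HasDerivAt (fun r : ℝ => form (N (z + r • (-a • w))) q)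
      (-a * form (fderiv ℝ N z w) t) 0 := by
    have h1 : HasFDerivAt N (fderiv ℝ N z) (z + (0 : ℝ) • (-a • w)) := by
      rw [hz0]; exact hasFDerivAt_normal hN z
    refine ((formCLM.flip q).hasFDerivAt.comp_hasDerivAt (0 : ℝ)
      (h1.comp_hasDerivAt (0 : ℝ) hline)).congr_deriv ?_
    rw [map_smul, ← hNq]
    simp
  have hG := eventually_lt_of_hasDerivAt_pos ((hdv.const_mul b).sub (hdu.const_mul (k * a))) (by
    have h2 : k * a * (-a * form t q) = -(k * form t q) := by
      linear_combination (-(k * form t q)) * ha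
    have h3 : -|form (fderiv ℝ N z w) t| ≤ -(a * b * form (fderiv ℝ N z w) t) := by
      rw [← neg_mul, neg_le, ← neg_mul, neg_neg]
      exact mul_le_abs_of_sq_eq_one (by rw [mul_pow, ha, hb, one_mul]) _
    rw [h2]
    have h4 := mul_pos (sub_pos.2 hk) hτ
    linarith)
  have hU := eventually_lt_of_hasDerivAt_pos (hdu.const_mul (-a)) (by
    have : -a * (-a * form t q) = form t q := by linear_combination form t q * ha
    rwa [this])
  have hpos : ∀ᶠ r in 𝓝[>] (0 : ℝ), 0 < a * form (s (z + r • (-a • w))) q := by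
    refine nhdsWithin_le_nhds ((hdu.const_mul a).continuousAt.eventually (lt_mem_nhds ?_))
    simp only [hz0, hau]
    linarith
  obtain ⟨r, hr1, hr2, hr3⟩ := (hG.and (hU.and hpos)).exists
  simp only [Pi.sub_apply, hz0] at hr1 hr2
  have habs1 : |a| = 1 := by rw [← sq_eq_sq₀ (abs_nonneg a) zero_le_one, sq_abs, ha, one_pow]
  have habs : |form (s (z + r • (-a • w))) q| = a * form (s (z + r • (-a • w))) q := by
    rw [← abs_of_pos hr3, abs_mul, habs1, one_mul]
  have hmem : z + r • (-a • w) ∈ C := by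
    have : |form (s z) q| ≤ |form (s z₀) q| := hz
    change |form (s (z + r • (-a • w))) q| ≤ _
    rw [habs]
    linarith
  have h1 := hmax hmem
  simp only [mem_ofPred_eq] at h1
  rw [habs] at h1
  have h2 := mul_le_abs_of_sq_eq_one hb (form (N (z + r • (-a • w))) q)
  rw [mul_assoc k, mul_assoc k, hau, hbv] at hr1
  linarith

/-- The estimate at the points of the surface extends to the boundary at infinity. -/
theorem abs_form_normal_rep_le (hs : IsSection S F s) (h0 : s 0 = p)
    (hS : IsSpacelikeSurface S) (hS' : frontierAtInfinity S ⊆ boundaryAtInfinity)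
    (hconn : PreconnectedSpace S) (hcurv : curvatureNorm S < 1) (hN : IsUnitNormal univ s N)
    {k : ℝ} (hk : (curvatureNorm S).toReal < k) (z : E2) {y : RP3} (hy : y ∈ closure S) :
    |form (N z) y.rep| ≤ k * |form (s z) y.rep| := by
  let C : Set R22 := {x | |form (N z) x| ≤ k * |form (s z) x|}
  have hCc : ∀ c : ℝ, c ≠ 0 → ∀ x ∈ C, c • x ∈ C := by
    intro c _ x hx
    have hx' : |form (N z) x| ≤ k * |form (s z) x| := hx
    change |form (N z) (c • x)| ≤ k * |form (s z) (c • x)|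
    rw [form_smul_right, form_smul_right, abs_mul, abs_mul, mul_left_comm]
    exact mul_le_mul_of_nonneg_left hx' (abs_nonneg c)
  have hcl : IsClosed {y : RP3 | y.rep ∈ C} := isClosed_rep_mem hCc <|
    isClosed_le (formCLM (N z)).continuous.abs
      (continuous_const.mul (formCLM (s z)).continuous.abs)
  refine closure_minimal (fun y hy => ?_) hcl hy
  obtain ⟨U, f, hf, u, hu, rfl⟩ := hS y hy
  exact (rep_mk_mem_iff hCc _).2
    (hs.abs_form_normal_le h0 hS hS' hconn hcurv hN hk (hf.mem_doubleCover hu) z)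

/-- On the frontier `|v| ≤ k|u|` with `k < c`, so `c u² - σ u v` is positive there. It is the side
product of the planes `(σN - c s)^⊥` and `s^⊥`, hence is nonnegative on the hull. -/
theorem abs_form_mul_form_le (hs : IsSection S F s) (h0 : s 0 = p)
    (hS : IsSpacelikeSurface S) (hS' : frontierAtInfinity S ⊆ boundaryAtInfinity)
    (hconn : PreconnectedSpace S) (hcurv : curvatureNorm S < 1) (hN : IsUnitNormal univ s N)
    {c : ℝ} (hc : (curvatureNorm S).toReal < c) (z : E2) {x : R22} (hx : x ∈ AdSHat)
    (hhull : proj x hx ∈ convexHullAtInfinity (frontierAtInfinity S)) {σ : ℝ} (hσ : σ ^ 2 = 1) :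
    σ * (form (s z) x * form (N z) x) ≤ c * form (s z) x ^ 2 := by
  obtain ⟨k, hk, hkc⟩ := exists_between hc
  have hside : ∀ y ∈ frontierAtInfinity S, 0 < sideProduct (σ • N z - c • s z) (-s z) y := by
    intro y hy
    have hle := hs.abs_form_normal_rep_le h0 hS hS' hconn hcurv hN hk z hy.1
    -- Otherwise `v = 0` as well, and a null vector orthogonal to both timelike vectors `s z` and `N
    -- z` is zero.
    have hu : form (s z) y.rep ≠ 0 := by
      intro hu
      rw [hu, abs_zero, mul_zero] at hle
      have hv := abs_nonpos_iff.1 hle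
      obtain ⟨_, _, G⟩ := exists_isFrame (hs.form_self z) (hN.unit z (mem_univ z))
        (by rw [form_comm]; exact hN.tangent z (mem_univ z))
      exact y.rep_nonzero (G.eq_zero_of_form_nonpos (by rw [form_comm, hu])
        (by rw [form_comm, hv]) (le_of_eq (hS' hy)))
    have h1 : σ * (form (s z) y.rep * form (N z) y.rep) ≤ k * form (s z) y.rep ^ 2 := by
      refine (mul_le_abs_of_sq_eq_one hσ _).trans ?_
      rw [abs_mul, ← sq_abs (form (s z) y.rep)]
      nlinarith [abs_nonneg (form (s z) y.rep)]
    have h2 : 0 < (c - k) * form (s z) y.rep ^ 2 := by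
      have := sub_pos.2 hkc
      positivity
    simp only [sideProduct, form_sub_left, form_smul_left, form_neg_left]
    nlinarith
  have h := hhull _ _ hside
  have h' : 0 ≤ form (σ • N z - c • s z) x * form (-s z) x := by
    refine (rep_mk_mem_iff (C := {x | 0 ≤ form (σ • N z - c • s z) x * form (-s z) x}) ?_
      (ne_zero_of_mem_AdSHat hx)).1 h
    intro t _ y hy
    have hy' : 0 ≤ form (σ • N z - c • s z) y * form (-s z) y := hy
    change 0 ≤ form (σ • N z - c • s z) (t • y) * form (-s z) (t • y)
    rw [form_smul_right, form_smul_right]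
    nlinarith [mul_nonneg (sq_nonneg t) hy']
  simp only [form_sub_left, form_smul_left, form_neg_left] at h'
  linarith

end IsSection

/-- Points of the convex hull are close to the surface along timelike geodesics. -/
theorem one_le_mul_form_sq (hS : IsSpacelikeSurface S)
    (hS' : frontierAtInfinity S ⊆ boundaryAtInfinity)
    (hconn : PreconnectedSpace S) (hcurv : curvatureNorm S < 1)
    {c : ℝ} (hc : (curvatureNorm S).toReal < c) {q : R22} (hq : q ∈ doubleCover S) {x : R22}
    (hx : x ∈ AdSHat) (hhull : proj x hx ∈ convexHullAtInfinity (frontierAtInfinity S))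
    (hqx : form q x ≠ 0) : 1 ≤ (1 + c ^ 2) * form q x ^ 2 := by
  obtain ⟨e₁, e₂, v, F, s, hs, h0⟩ := exists_centered_section hS hS' hq
  obtain ⟨N, hN⟩ := hs.exists_isUnitNormal
  have h1 := hs.abs_form_mul_form_le h0 hS hS' hconn hcurv hN hc 0 hx hhull (one_pow 2)
  have h2 := hs.abs_form_mul_form_le h0 hS hS' hconn hcurv hN hc 0 hx hhull (σ := -1) (by norm_num)
  have h3 := hs.one_le_sq_add_sq hN 0 hx
  rw [h0] at h1 h2 h3
  have hu : 0 < form q x ^ 2 := by positivity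
  have hc0 : 0 ≤ c := ENNReal.toReal_nonneg.trans hc.le
  have h4 : (form q x * form (N 0) x) ^ 2 ≤ (c * form q x ^ 2) ^ 2 :=
    sq_le_sq' (by linarith) (by linarith)
  have h5 : form (N 0) x ^ 2 ≤ c ^ 2 * form q x ^ 2 := by
    refine le_of_mul_le_mul_left ?_ hu
    linarith
  linarith

/-! ### The width of the convex hull -/

/-- Every complete timelike geodesic meets the surface. -/
theorem exists_geodesic_mem (hS : IsSpacelikeSurface S)
    (hS' : frontierAtInfinity S ⊆ boundaryAtInfinity) {q : R22} (hq : q ∈ doubleCover S)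
    (hp : form p p = -1) (hv : form v v = -1) (hpv : form p v = 0) :
    ∃ t : ℝ, Real.cos t • p + Real.sin t • v ∈ doubleCover S := by
  obtain ⟨e₁, e₂, F⟩ := exists_isFrame hp hv hpv
  obtain ⟨s, hs, -⟩ := exists_isSection hS hS' F hq
  -- The point of the section over the origin lies in the plane of `p` and `v`, hence on the
  -- geodesic; its time is a complex argument.
  have hc := hs.coords 0
  have hx1 : form (s 0) e₁ = 0 := by rw [← F.coords_zero, hc]; rfl
  have hx2 : form (s 0) e₂ = 0 := by rw [← F.coords_one, hc]; rfl
  have hself := F.form_self (s 0)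
  rw [hs.form_self, hx1, hx2] at hself
  have hexp := F.expand (s 0)
  rw [hx1, hx2] at hexp
  let ζ : ℂ := ⟨-form (s 0) p, -form (s 0) v⟩
  have hζ : ‖ζ‖ = 1 := by
    rw [← sq_eq_sq₀ (norm_nonneg _) zero_le_one, Complex.sq_norm, Complex.normSq_mk]
    linarith
  have h1 : Real.cos ζ.arg = -form (s 0) p := by
    rw [Complex.cos_arg (by rintro h; simp [h] at hζ), hζ, div_one]
  have h2 : Real.sin ζ.arg = -form (s 0) v := by rw [Complex.sin_arg, hζ, div_one]
  refine ⟨ζ.arg, ?_⟩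
  convert hs.mem 0 using 1
  rw [h1, h2]
  conv_rhs => rw [hexp]
  module

/-- On an interval of length greater than `2ρ`, some point is at distance in `(ρ, π / 2)` from
the lattice `t₀ + π ℤ`. -/
theorem exists_cos_mem_Ioo {L ρ : ℝ} (hρ : 0 ≤ ρ) (hρ4 : ρ < Real.pi / 4) (hL : 2 * ρ < L)
    (t₀ : ℝ) : ∃ t ∈ Icc 0 L, Real.cos (t - t₀) ≠ 0 ∧ Real.cos (t - t₀) ^ 2 < Real.cos ρ ^ 2 := by
  obtain ⟨r, hr, hr'⟩ := exists_between (lt_min hρ4 (show ρ < L / 2 by linarith))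
  have hr4 : r < Real.pi / 4 := hr'.trans_le (min_le_left _ _)
  have hrL : r < L / 2 := hr'.trans_le (min_le_right _ _)
  have hr0 : 0 < r := hρ.trans_lt hr
  let g : ℝ → ℝ := fun t => Real.cos (2 * (t - t₀))
  have hg : ∀ t, g t = 2 * Real.cos (t - t₀) ^ 2 - 1 := fun t => Real.cos_two_mul _
  suffices h : ∃ t ∈ Icc 0 L, -1 < g t ∧ g t < Real.cos (2 * ρ) by
    obtain ⟨t, ht, h1, h2⟩ := h
    rw [hg] at h1 h2
    rw [Real.cos_two_mul] at h2
    refine ⟨t, ht, fun h0 => ?_, by linarith⟩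
    rw [h0] at h1
    norm_num at h1
  have hcosr : Real.cos (2 * r) < Real.cos (2 * ρ) :=
    Real.cos_lt_cos_of_nonneg_of_le_pi (by linarith) (by linarith [Real.pi_pos]) (by linarith)
  have hcosr0 : 0 < Real.cos (2 * r) :=
    Real.cos_pos_of_mem_Ioo ⟨by linarith [Real.pi_pos], by linarith⟩
  have hcosr1 : Real.cos (2 * r) < 1 := hcosr.trans_le (Real.cos_le_one _)
  -- By the intermediate value theorem, avoiding the target range forces `g` to be constantly `-1`
  -- or always at least `cos 2ρ`. Sampling at `0, r, 2r` with `r > ρ` excludes both.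
  have hsum : g 0 + g (2 * r) = 2 * g r * Real.cos (2 * r) := by
    have h1 : 2 * ((0 : ℝ) - t₀) = 2 * (r - t₀) - 2 * r := by ring
    have h2 : 2 * (2 * r - t₀) = 2 * (r - t₀) + 2 * r := by ring
    simp only [g]
    rw [h1, h2, Real.cos_sub, Real.cos_add]
    ring
  by_contra! hcon
  have m0 : (0 : ℝ) ∈ Icc 0 L := ⟨le_rfl, by linarith⟩
  have m1 : r ∈ Icc 0 L := ⟨by linarith, by linarith⟩
  have m2 : 2 * r ∈ Icc 0 L := ⟨by linarith, by linarith⟩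
  have hge : ∀ t, -1 ≤ g t := fun t => Real.neg_one_le_cos _
  by_cases hex : ∃ t ∈ Icc 0 L, Real.cos (2 * ρ) ≤ g t
  · obtain ⟨t₁, ht₁, h₁⟩ := hex
    have hall : ∀ t ∈ Icc 0 L, Real.cos (2 * ρ) ≤ g t := by
      intro t ht
      by_contra! hlt
      have hgt : g t = -1 := by
        refine le_antisymm ?_ (hge t)
        by_contra! h
        exact absurd (hcon t ht h) (not_le.2 hlt)
      obtain ⟨t₂, ht₂, h₂⟩ := isPreconnected_Icc.intermediate_value ht ht₁
        (f := g) (by fun_prop : Continuous g).continuousOn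
        (show (Real.cos (2 * ρ) - 1) / 2 ∈ Icc (g t) (g t₁) from
          ⟨by rw [hgt]; linarith, by linarith [Real.cos_le_one (2 * ρ)]⟩)
      have := hcon t₂ ht₂ (by rw [h₂]; linarith)
      linarith
    have h0 := hall 0 m0
    have h2 := hall _ m2
    have h3 : g r ≤ 1 := Real.cos_le_one _
    nlinarith
  · push Not at hex
    have hall : ∀ t ∈ Icc 0 L, g t = -1 := by
      intro t ht
      refine le_antisymm ?_ (hge t)
      by_contra! h
      exact absurd (hcon t ht h) (not_le.2 (hex t ht))
    rw [hall 0 m0, hall _ m2, hall r m1] at hsum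
    linarith

theorem timelikeGeodesicLength_le (hS : IsSpacelikeSurface S)
    (hS' : frontierAtInfinity S ⊆ boundaryAtInfinity)
    (hconn : PreconnectedSpace S) (hcurv : curvatureNorm S < 1) (hne : S.Nonempty) {L : ℝ}
    (hL : IsTimelikeGeodesicLength (convexHullAtInfinity (frontierAtInfinity S)) L) :
    L ≤ 2 * Real.arctan (curvatureNorm S).toReal := by
  obtain ⟨-, -, p, v, hp, hv, hpv, hgeo⟩ := hL
  by_contra! hlt
  have hK1 : (curvatureNorm S).toReal < 1 := by
    rw [← ENNReal.toReal_one]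
    exact (ENNReal.toReal_lt_toReal (ne_top_of_lt hcurv) ENNReal.one_ne_top).2 hcurv
  have hK4 : Real.arctan (curvatureNorm S).toReal < Real.pi / 4 := by
    rw [← Real.arctan_one]
    exact Real.arctan_strictMono hK1
  have hK0 : 0 ≤ Real.arctan (curvatureNorm S).toReal := by
    rw [← Real.arctan_zero]
    exact Real.arctan_strictMono.monotone ENNReal.toReal_nonneg
  -- Strict room on both sides: `tan ρ` exceeds `K` and serves as the constant `c` of the hull
  -- estimate, while `2ρ < L` leaves a point of the segment violating it.
  obtain ⟨ρ, hρ, hρ'⟩ := exists_between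
    (lt_min hK4 (show Real.arctan (curvatureNorm S).toReal < L / 2 by linarith))
  have hρ4 : ρ < Real.pi / 4 := hρ'.trans_le (min_le_left _ _)
  have hρL : ρ < L / 2 := hρ'.trans_le (min_le_right _ _)
  have hc : (curvatureNorm S).toReal < Real.tan ρ := by
    rw [← Real.tan_arctan (curvatureNorm S).toReal]
    exact Real.tan_lt_tan_of_nonneg_of_lt_pi_div_two hK0 (by linarith [Real.pi_pos]) hρ
  have hcosρ : 0 < Real.cos ρ := Real.cos_pos_of_mem_Ioo ⟨by linarith [Real.pi_pos],
    by linarith [Real.pi_pos]⟩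
  obtain ⟨y, hy⟩ := hne
  obtain ⟨U, f, hf, u, hu, -⟩ := hS y hy
  obtain ⟨t₀, ht₀⟩ := exists_geodesic_mem hS hS' (hf.mem_doubleCover hu) hp hv hpv
  obtain ⟨t, ht, h1, h2⟩ := exists_cos_mem_Ioo (hK0.trans hρ.le) hρ4
    (show 2 * ρ < L by linarith) t₀
  have hp' : form p p = -1 := hp
  have hform : form (Real.cos t₀ • p + Real.sin t₀ • v) (Real.cos t • p + Real.sin t • v) =
      -Real.cos (t - t₀) := by
    simp only [form_add_left, form_smul_left, form_add_right, form_smul_right, hp', hv, hpv,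
      form_comm v p, Real.cos_sub]
    ring
  have h := one_le_mul_form_sq hS hS' hconn hcurv hc ht₀ (geodesic_mem_AdSHat hp hv hpv t)
    (hgeo t ht) (by rw [hform]; exact neg_ne_zero.2 h1)
  have htan : (1 + Real.tan ρ ^ 2) * Real.cos ρ ^ 2 = 1 := by
    have h1 := Real.tan_mul_cos hcosρ.ne'
    have h2 := Real.sin_sq_add_cos_sq ρ
    rw [← h1] at h2
    linarith
  rw [hform, neg_sq] at h
  have := mul_lt_mul_of_pos_left h2 (show 0 < 1 + Real.tan ρ ^ 2 by positivity)
  linarith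

theorem width_le (hS : IsSpacelikeSurface S)
    (hS' : frontierAtInfinity S ⊆ boundaryAtInfinity)
    (hconn : PreconnectedSpace S) (hcurv : curvatureNorm S < 1) (hne : S.Nonempty) :
    width (frontierAtInfinity S) ≤ 2 * Real.arctan (curvatureNorm S).toReal := by
  -- The remaining goal, nonnegativity of the bound, covers the default value `0` of `sSup` on the
  -- empty set.
  refine Real.sSup_le (fun L hL => timelikeGeodesicLength_le hS hS' hconn hcurv hne hL) ?_
  have := Real.arctan_strictMono.monotone (ENNReal.toReal_nonneg (a := curvatureNorm S))
  rw [Real.arctan_zero] at this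
  linarith

theorem IsEntire.preconnectedSpace (hS : IsEntire S) : PreconnectedSpace S := by
  obtain ⟨⟨e⟩, -⟩ := hS
  have : PreconnectedSpace (Metric.ball (0 : E2) 1) :=
    Subtype.preconnectedSpace (convex_ball (0 : E2) 1).isPreconnected
  exact e.symm.surjective.denseRange.preconnectedSpace e.symm.continuous

theorem IsEntire.nonempty (hS : IsEntire S) : S.Nonempty := by
  obtain ⟨⟨e⟩, -⟩ := hS
  exact ⟨e.symm ⟨0, Metric.mem_ball_self one_pos⟩, Subtype.property _⟩

end AdS

end

theorem propositionC (S : Set AdS.RP3) (hmax : AdS.IsMaximalSurface S) (hent : AdS.IsEntire S)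
    (hcurv : AdS.curvatureNorm S < 1) :
    AdS.width (AdS.frontierAtInfinity S) < Real.pi / 2 ∧
      Real.tan (AdS.width (AdS.frontierAtInfinity S)) ≤
        2 * (AdS.curvatureNorm S).toReal / (1 - (AdS.curvatureNorm S).toReal ^ 2) := by
  have hw := AdS.width_le hmax.1 hent.2 hent.preconnectedSpace hcurv hent.nonempty
  have hK1 : (AdS.curvatureNorm S).toReal < 1 := by
    rw [← ENNReal.toReal_one]
    exact (ENNReal.toReal_lt_toReal (ne_top_of_lt hcurv) ENNReal.one_ne_top).2 hcurv
  have hK4 : Real.arctan (AdS.curvatureNorm S).toReal < Real.pi / 4 := by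
    rw [← Real.arctan_one]
    exact Real.arctan_strictMono hK1
  have hw0 : 0 ≤ AdS.width (AdS.frontierAtInfinity S) := Real.sSup_nonneg fun L hL => hL.1
  refine ⟨by linarith, ?_⟩
  have hmono := Real.strictMonoOn_tan.monotoneOn
    (show AdS.width (AdS.frontierAtInfinity S) ∈ Set.Ioo (-(Real.pi / 2)) (Real.pi / 2) from
      ⟨by linarith [Real.pi_pos], by linarith⟩)
    (show 2 * Real.arctan (AdS.curvatureNorm S).toReal ∈ Set.Ioo (-(Real.pi / 2)) (Real.pi / 2) from
      ⟨by linarith [Real.pi_pos], by linarith⟩) hw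
  rwa [Real.tan_two_mul, Real.tan_arctan] at hmono
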